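/- Let $\mathbb{R}_+=[0,\infty)$. Write $f\in L_{2,loc}(\mathbb{R}_+)$ if $f\in L_2[0,b]$ for every $b>0$, and $f\in AC_{loc}(\mathbb{R}_+)$ if $f$ is absolutely continuous on $[0,b]$ for every $b>0$. For a complex-valued $s\in L_{2,loc}(\mathbb{R}_+)$ put $$y^{[1]}=y'-sy,\qquad l(y)=-(y^{[1]})'-s\,y^{[1]}-s^2y ,$$ which is a regularization of $-y''+qy$ with the potential $q=s'$ (derivative in the sense of distributions); $s$ is called a generalized antiderivative of the potential. The minimal operator $L_0$ constructed from $s$ acts in $L_2(\mathbb{R}_+)$ by $L_0y=l(y)$ on the domain $$\mathscr{D}_0=\{y\in L_2(\mathbb{R}_+):\ y,\,y^{[1]}\in AC_{loc}(\mathbb{R}_+),\ l(y)\in L_2(\mathbb{R}_+),\ y(0)=y^{[1]}(0)=0,\ \operatorname{supp}y \text{ is compact}\}.$$ It is called semi-bounded if there is $m\in\mathbb{R}$ such that $(L_0y,y)$ is real and $(L_0y,y)\ge m$ for all $y\in\mathscr{D}_0$ with $\|y\|=1$. **Lemma.** Let $s\in L_{2,loc}(\mathbb{R}_+)$ be complex-valued.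 The minimal operator $L_0$ constructed from $s$ is semi-bounded if and only if there exist a real-valued $\gamma\in L_{2,loc}(\mathbb{R}_+)$, a constant $b\in\mathbb{R}$ and a constant of integration $C\in\mathbb{C}$ such that $$s(x)=bx+\gamma(x)+\int_0^x\gamma^2(t)\,dt+C\qquad\text{for almost all }x\in\mathbb{R}_+ .$$ -/

import Mathlib

open MeasureTheory Set

/-- Lebesgue measure on the half-line `ℝ₊ = [0, ∞)`. -/
noncomputable abbrev halfLine : Measure ℝ := volume.restrict (Ici (0 : ℝ))

/-- The complex Hilbert space `L₂(ℝ₊)`. -/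
abbrev L2HalfLine : Type := Lp ℂ 2 halfLine

/-- `f ∈ L_{2,loc}(ℝ₊)`: `f` is square integrable on `[0, b]` for every `b`. -/
def MemL2Loc {E : Type*} [NormedAddCommGroup E] (f : ℝ → E) : Prop :=
  ∀ b : ℝ, MemLp f 2 (volume.restrict (Icc (0 : ℝ) b))

/-- `f ∈ AC_loc(ℝ₊)`: `f` is absolutely continuous on `[0, b]` for every `b ≥ 0`. -/
def ACLoc (f : ℝ → ℂ) : Prop :=
  ∀ b : ℝ, 0 ≤ b → AbsolutelyContinuousOnInterval f 0 b

/-- The quasi-derivative `y^{[1]} = y' - s y`. -/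
noncomputable def quasiDeriv (s y : ℝ → ℂ) (x : ℝ) : ℂ := deriv y x - s x * y x

/-- The differential expression `l(y) = -(y^{[1]})' - s y^{[1]} - s² y`, with `z = y^{[1]}`. -/
noncomputable def diffExpr (s y z : ℝ → ℂ) (x : ℝ) : ℂ :=
  -deriv z x - s x * z x - s x ^ 2 * y x

/-- `(u, v)` lies in the graph of the maximal operator, i.e. `u ∈ 𝒟` and `v = l(u) ∈ L₂(ℝ₊)`.
Here `y` is the locally absolutely continuous representative of the class `u`, and `z` is the
locally absolutely continuous representative of its quasi-derivative. -/
structure MaximalPair (s : ℝ → ℂ) (u v : L2HalfLine) (y z : ℝ → ℂ) : Prop where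
  rep : u =ᵐ[halfLine] y
  ac : ACLoc y
  quasi_ac : ACLoc z
  quasi_eq : z =ᵐ[halfLine] quasiDeriv s y
  expr_eq : v =ᵐ[halfLine] diffExpr s y z

/-- `(u, v)` lies in the graph of the minimal operator: in addition `y(0) = y^{[1]}(0) = 0` and the
support of `y` in `[0, ∞)` is compact. -/
structure MinimalPair (s : ℝ → ℂ) (u v : L2HalfLine) (y z : ℝ → ℂ) : Prop
    extends MaximalPair s u v y z where
  init : y 0 = 0
  quasi_init : z 0 = 0
  compact_supp : ∃ b : ℝ, ∀ x : ℝ, b < x → 0 ≤ x → y x = 0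

theorem ACLoc.add {f g : ℝ → ℂ} (hf : ACLoc f) (hg : ACLoc g) : ACLoc (f + g) :=
  fun b hb => (hf b hb).add (hg b hb)

theorem ACLoc.const_smul {f : ℝ → ℂ} (hf : ACLoc f) (c : ℂ) : ACLoc (c • f) :=
  fun b hb => (hf b hb).const_smul c

theorem ACLoc.zero : ACLoc 0 := fun b _ =>
  ((LipschitzWith.const (0 : ℂ)).lipschitzOnWith (s := uIcc 0 b)).absolutelyContinuousOnInterval

theorem ACLoc.continuousOn {f : ℝ → ℂ} (hf : ACLoc f) : ContinuousOn f (Ici 0) := by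
  intro x hx
  have hx' : (0 : ℝ) ≤ x := hx
  have h := (hf (x + 1) (by linarith)).continuousOn
  rw [uIcc_of_le (by linarith)] at h
  refine (h x ⟨hx', by linarith⟩).mono_of_mem_nhdsWithin ?_
  have : Ici (0 : ℝ) ∩ Iio (x + 1) ⊆ Icc 0 (x + 1) := fun t ht => ⟨ht.1, le_of_lt ht.2⟩
  exact Filter.mem_of_superset (inter_mem_nhdsWithin _ (Iio_mem_nhds (by linarith))) this

theorem ae_pos_halfLine : ∀ᵐ x ∂halfLine, 0 < x := by
  have h : ∀ᵐ x : ℝ ∂halfLine, x ≠ 0 := by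
    refine ae_restrict_of_ae ?_
    simp [ae_iff]
  filter_upwards [h, ae_restrict_mem measurableSet_Ici] with x h1 h2
  exact lt_of_le_of_ne h2 (Ne.symm h1)

theorem ACLoc.ae_differentiableAt {f : ℝ → ℂ} (hf : ACLoc f) :
    ∀ᵐ x ∂halfLine, DifferentiableAt ℝ f x := by
  have h : ∀ n : ℕ, ∀ᵐ x : ℝ, x ∈ uIcc (0 : ℝ) n → DifferentiableAt ℝ f x := fun n =>
    (hf n (Nat.cast_nonneg n)).boundedVariationOn.ae_differentiableAt_of_mem_uIcc
  filter_upwards [ae_restrict_of_ae (ae_all_iff.2 h), ae_pos_halfLine] with x hx hpos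
  obtain ⟨n, hn⟩ := exists_nat_ge x
  exact hx n (by rw [uIcc_of_le (Nat.cast_nonneg n)]; exact ⟨hpos.le, hn⟩)

theorem eqOn_zero_of_ae {f : ℝ → ℂ} (hf : ACLoc f) (h : f =ᵐ[halfLine] 0) :
    ∀ x, 0 ≤ x → f x = 0 := by
  have h1 : f =ᵐ[volume.restrict (Ioi (0 : ℝ))] (fun _ => 0) :=
    ae_restrict_of_ae_restrict_of_subset Ioi_subset_Ici_self h
  have hc := hf.continuousOn
  have h2 : EqOn f (fun _ => 0) (Ioi 0) :=
    Measure.eqOn_open_of_ae_eq h1 isOpen_Ioi (hc.mono Ioi_subset_Ici_self) continuousOn_const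
  have h3 : EqOn f (fun _ => 0) (Ici 0) :=
    h2.of_subset_closure hc continuousOn_const Ioi_subset_Ici_self (by rw [closure_Ioi])
  exact fun x hx => h3 hx

theorem deriv_zero_of_eqOn {f : ℝ → ℂ} (h : ∀ x, 0 ≤ x → f x = 0) :
    ∀ x, 0 < x → deriv f x = 0 := by
  intro x hx
  have : f =ᶠ[nhds x] fun _ => 0 := by
    filter_upwards [Ioi_mem_nhds hx] with t ht using h t (le_of_lt ht)
  rw [this.deriv_eq]; simp

/-- The graph `{(y, l(y)) : y ∈ 𝒟₀}` of the minimal operator, a subspace of `L₂(ℝ₊) × L₂(ℝ₊)`. -/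
def minimalGraph (s : ℝ → ℂ) : Submodule ℂ (L2HalfLine × L2HalfLine) where
  carrier := {p | ∃ y z : ℝ → ℂ, MinimalPair s p.1 p.2 y z}
  zero_mem' := by
    refine ⟨0, 0, ⟨⟨Lp.coeFn_zero _ _ _, ACLoc.zero, ACLoc.zero, ?_, ?_⟩, rfl, rfl, ⟨0, fun _ _ _ => rfl⟩⟩⟩
    · exact Filter.Eventually.of_forall fun x => by
        simp [quasiDeriv, deriv_zero]
    · filter_upwards [Lp.coeFn_zero ℂ 2 halfLine] with x hx
      simp only [Prod.snd_zero]
      rw [hx]; simp [diffExpr, deriv_zero]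
  add_mem' := by
    rintro p q ⟨y, z, h⟩ ⟨y', z', h'⟩
    refine ⟨y + y', z + z', ⟨⟨?_, h.ac.add h'.ac, h.quasi_ac.add h'.quasi_ac, ?_, ?_⟩, ?_, ?_, ?_⟩⟩
    · exact (Lp.coeFn_add _ _).trans (h.rep.add h'.rep)
    · filter_upwards [h.quasi_eq, h'.quasi_eq, h.ac.ae_differentiableAt,
        h'.ac.ae_differentiableAt] with x h1 h2 h3 h4
      simp only [Pi.add_apply, h1, h2, quasiDeriv, deriv_add h3 h4]
      ring
    · filter_upwards [Lp.coeFn_add p.2 q.2, h.expr_eq, h'.expr_eq,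
        h.quasi_ac.ae_differentiableAt, h'.quasi_ac.ae_differentiableAt] with x h0 h1 h2 h3 h4
      simp only [Prod.snd_add, h0, Pi.add_apply, h1, h2, diffExpr, deriv_add h3 h4]
      ring
    · simp [h.init, h'.init]
    · simp [h.quasi_init, h'.quasi_init]
    · obtain ⟨b, hb⟩ := h.compact_supp
      obtain ⟨b', hb'⟩ := h'.compact_supp
      refine ⟨max b b', fun x hx h0 => ?_⟩
      simp [hb x ((le_max_left _ _).trans_lt hx) h0, hb' x ((le_max_right _ _).trans_lt hx) h0]
  smul_mem' := by
    rintro c p ⟨y, z, h⟩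
    refine ⟨c • y, c • z, ⟨⟨?_, h.ac.const_smul c, h.quasi_ac.const_smul c, ?_, ?_⟩, ?_, ?_, ?_⟩⟩
    · exact (Lp.coeFn_smul _ _).trans (h.rep.const_smul c)
    · filter_upwards [h.quasi_eq, h.ac.ae_differentiableAt] with x h1 h3
      simp only [Pi.smul_apply, h1, quasiDeriv, deriv_const_smul c h3, smul_eq_mul]
      ring
    · filter_upwards [Lp.coeFn_smul c p.2, h.expr_eq,
        h.quasi_ac.ae_differentiableAt] with x h0 h1 h3
      simp only [Prod.smul_snd, h0, Pi.smul_apply, h1, diffExpr, deriv_const_smul c h3, smul_eq_mul]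
      ring
    · simp [h.init]
    · simp [h.quasi_init]
    · obtain ⟨b, hb⟩ := h.compact_supp
      exact ⟨b, fun x hx h0 => by simp [hb x hx h0]⟩

/-- `l(y)` depends only on the class of `y` in `L₂(ℝ₊)`, so `minimalGraph s` is indeed the graph
of an operator. -/
theorem minimalGraph_single_valued (s : ℝ → ℂ) (p : L2HalfLine × L2HalfLine)
    (hp : p ∈ minimalGraph s) (hp0 : p.1 = 0) : p.2 = 0 := by
  obtain ⟨y, z, h⟩ := hp
  have hy : y =ᵐ[halfLine] 0 := by
    have h1 := h.rep
    rw [hp0] at h1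
    exact h1.symm.trans (Lp.coeFn_zero _ _ _)
  have hy0 := eqOn_zero_of_ae h.ac hy
  have hz : z =ᵐ[halfLine] 0 := by
    filter_upwards [h.quasi_eq, ae_pos_halfLine] with x hx hpos
    simp [hx, quasiDeriv, hy0 x hpos.le, deriv_zero_of_eqOn hy0 x hpos]
  have hz0 := eqOn_zero_of_ae h.quasi_ac hz
  refine Lp.ext ?_
  filter_upwards [h.expr_eq, ae_pos_halfLine, Lp.coeFn_zero ℂ 2 halfLine] with x hx hpos h0
  rw [hx, h0]
  simp [diffExpr, hy0 x hpos.le, hz0 x hpos.le, deriv_zero_of_eqOn hz0 x hpos]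

/-- The minimal operator `L₀ y = l(y)`, `y ∈ 𝒟₀`, in `L₂(ℝ₊)`, for the potential `s'`. -/
noncomputable def minimalOperator (s : ℝ → ℂ) : L2HalfLine →ₗ.[ℂ] L2HalfLine :=
  (minimalGraph s).toLinearPMap

theorem minimalOperator_graph (s : ℝ → ℂ) : (minimalOperator s).graph = minimalGraph s :=
  (minimalGraph s).toLinearPMap_graph_eq fun p hp h0 => minimalGraph_single_valued s p hp h0

/-- The closed sector `{z₀ + z : arg z ∈ [α, β]}` (including its vertex). -/
def sector (α β : ℝ) (z₀ : ℂ) : Set ℂ :=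
  {w | ∃ r : ℝ, 0 ≤ r ∧ ∃ θ ∈ Icc α β, w = z₀ + r * Complex.exp (θ * Complex.I)}

/-- An operator is semi-bounded if its numerical range lies in a sector with zero angles and a real
vertex. The inner product of Mathlib is linear in its second argument. -/
def IsSemibounded {H : Type*} [NormedAddCommGroup H] [InnerProductSpace ℂ H]
    (T : H →ₗ.[ℂ] H) : Prop :=
  ∃ m : ℝ, ∀ y : T.domain, ‖(y : H)‖ = 1 → inner ℂ (y : H) (T y) ∈ sector 0 0 (m : ℂ)

/-!
If `s = bx + γ + ∫₀ˣ γ² + C` and `τ = bx + ∫₀ˣ γ² + C`, then `y^{[1]} + τ y = y' - γ y`, and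
integrating by parts gives `(L₀ y, y) = b ‖y‖² + ‖y' - γ y‖²`.

Conversely, let the form be real and bounded below. Inserting `y = g u` with `g` a test function and
`l(u) = 0` into `Im (L₀ y, y) = 0` yields a weak differential equation for `κ |u|²`, `κ = Im s`.
Summing it over two independent solutions `u₁, u₂`, for which `p = |u₁|² + |u₂|²` has no zeros,
gives `(κ p)' = κ p'`, so `κ` is constant. Hence `s` differs by an affine function from a real `σ`
whose form is bounded below by `1`, and it suffices to find a positive solution of `l(u) = 0` for
`σ`: then `τ = u^{[1]} / u` solves the Riccati equation `τ' = -(σ + τ)²`, and `γ = σ + τ` is as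
required.

The real solutions are `ρ sin (θ + δ)` with `θ' = ρ⁻²` and `θ(0) = 0`, up to a constant factor. In
these variables the form of `y = ρ φ(θ)` on `[0, N]` becomes `∫ (φ'² - φ²)` over `[0, θ(N)]`. For
`φ(t) = sin (π t / θ(N))` it equals `(π² - θ(N)²) / (2 θ(N))`, and the lower bound `‖y‖²` keeps
`θ(N)` below some `M < π` independent of `N`. Therefore `ρ sin (θ + (π - M) / 2)` is positive.
-/

theorem ae_halfLine_iff {p : ℝ → Prop} : (∀ᵐ x ∂halfLine, p x) ↔ ∀ᵐ x, 0 < x → p x := by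
  rw [halfLine, Measure.restrict_congr_set Ioi_ae_eq_Ici.symm, ae_restrict_iff' measurableSet_Ioi]
  rfl

theorem locallyIntegrableOn_Ici_iff {E : Type*} [NormedAddCommGroup E] {f : ℝ → E} :
    LocallyIntegrableOn f (Ici 0) ↔ ∀ b, 0 ≤ b → IntervalIntegrable f volume 0 b := by
  rw [locallyIntegrableOn_iff isClosed_Ici.isLocallyClosed]
  constructor
  · intro h b hb
    rw [intervalIntegrable_iff_integrableOn_Icc_of_le hb]
    exact h _ Icc_subset_Ici_self isCompact_Icc
  · intro h k hk hk'
    obtain ⟨b, hb⟩ := hk'.bddAbove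
    refine ((intervalIntegrable_iff_integrableOn_Icc_of_le (le_max_left 0 b)).1
      (h _ (le_max_left 0 b))).mono_set fun x hx => ⟨hk hx, (hb hx).trans (le_max_right _ _)⟩

theorem intervalIntegrable_of_locallyIntegrableOn_Ici {E : Type*} [NormedAddCommGroup E]
    {f : ℝ → E} (hf : LocallyIntegrableOn f (Ici 0)) {a b : ℝ} (ha : 0 ≤ a) (hb : 0 ≤ b) :
    IntervalIntegrable f volume a b :=
  (locallyIntegrableOn_Ici_iff.1 hf a ha).symm.trans (locallyIntegrableOn_Ici_iff.1 hf b hb)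

theorem absolutelyContinuousOnInterval_of_dist_le {X Y : Type*} [PseudoMetricSpace X]
    [PseudoMetricSpace Y] {f : ℝ → X} {g : ℝ → Y} {a b C : ℝ}
    (hf : AbsolutelyContinuousOnInterval f a b)
    (h : ∀ x ∈ uIcc a b, ∀ y ∈ uIcc a b, dist (g x) (g y) ≤ C * dist (f x) (f y)) :
    AbsolutelyContinuousOnInterval g a b := by
  have hlim := Filter.Tendsto.const_mul C hf
  rw [mul_zero] at hlim
  refine squeeze_zero' (Filter.Eventually.of_forall fun E => Finset.sum_nonneg fun i _ =>
    dist_nonneg) (Filter.mem_inf_of_right (Filter.mem_principal.2 fun E hE => ?_)) hlim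
  change _ ≤ C * _
  rw [Finset.mul_sum]
  exact Finset.sum_le_sum fun i hi => h _ (hE.1 i hi).1 _ (hE.1 i hi).2

theorem continuousOn_Ici_of_forall_Icc {E : Type*} [TopologicalSpace E] {f : ℝ → E}
    (h : ∀ b, 0 ≤ b → ContinuousOn f (Icc 0 b)) : ContinuousOn f (Ici 0) := by
  intro x hx
  refine (h (x + 1) (add_nonneg hx zero_le_one) x ⟨hx, by linarith⟩).mono_of_mem_nhdsWithin ?_
  filter_upwards [self_mem_nhdsWithin, mem_nhdsWithin_of_mem_nhds (Iio_mem_nhds (lt_add_one x))]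
    with t ht0 ht1 using ⟨ht0, ht1.le⟩

/-- `f` is locally absolutely continuous on `[0, ∞)` with almost everywhere derivative `f'`. The
encoding by the fundamental theorem of calculus makes sense for values in any Banach space; see
`HasACDeriv.of_absolutelyContinuous`, `HasACDeriv.absolutelyContinuous` and
`HasACDeriv.ae_hasDerivAt` for the link with `AbsolutelyContinuousOnInterval`. -/
structure HasACDeriv {E : Type*} [NormedAddCommGroup E] [NormedSpace ℝ E] (f f' : ℝ → E) :
    Prop where
  locallyIntegrableOn : LocallyIntegrableOn f' (Ici 0)
  eq_add_integral : ∀ x, 0 ≤ x → f x = f 0 + ∫ t in (0 : ℝ)..x, f' t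

namespace HasACDeriv

section Banach

variable {E F : Type*} [NormedAddCommGroup E] [NormedSpace ℝ E] [NormedAddCommGroup F]
  [NormedSpace ℝ F] {f f' g g' : ℝ → E}

theorem intervalIntegrable (hf : HasACDeriv f f') {a b : ℝ} (ha : 0 ≤ a) (hb : 0 ≤ b) :
    IntervalIntegrable f' volume a b :=
  intervalIntegrable_of_locallyIntegrableOn_Ici hf.locallyIntegrableOn ha hb

theorem integral_eq_sub (hf : HasACDeriv f f') {a b : ℝ} (ha : 0 ≤ a) (hb : 0 ≤ b) :
    ∫ t in a..b, f' t = f b - f a := by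
  rw [hf.eq_add_integral a ha, hf.eq_add_integral b hb, add_sub_add_left_eq_sub,
    intervalIntegral.integral_interval_sub_left (hf.intervalIntegrable le_rfl hb)
      (hf.intervalIntegrable le_rfl ha)]

theorem congr (hf : HasACDeriv f f') (h : ∀ x, 0 ≤ x → f x = g x)
    (h' : f' =ᵐ[halfLine] g') : HasACDeriv g g' := by
  refine ⟨hf.locallyIntegrableOn.congr h', fun x hx => ?_⟩
  rw [← h x hx, ← h 0 le_rfl, hf.eq_add_integral x hx, add_right_inj]
  refine intervalIntegral.integral_congr_ae ?_
  filter_upwards [ae_halfLine_iff.1 h'] with t ht hmem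
  rw [uIoc_of_le hx] at hmem
  exact ht hmem.1

theorem congr_deriv (hf : HasACDeriv f f') (h' : f' =ᵐ[halfLine] g') : HasACDeriv f g' :=
  hf.congr (fun _ _ => rfl) h'

theorem primitive (hf : LocallyIntegrableOn f' (Ici 0)) (c : E) :
    HasACDeriv (fun x => c + ∫ t in (0 : ℝ)..x, f' t) f' :=
  ⟨hf, fun x _ => by simp⟩

theorem const (c : E) : HasACDeriv (fun _ => c) (fun _ => 0) :=
  ⟨locallyIntegrableOn_zero, fun x _ => by simp⟩

theorem add (hf : HasACDeriv f f') (hg : HasACDeriv g g') :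
    HasACDeriv (fun x => f x + g x) (fun x => f' x + g' x) := by
  refine ⟨hf.locallyIntegrableOn.add hg.locallyIntegrableOn, fun x hx => ?_⟩
  rw [intervalIntegral.integral_add (hf.intervalIntegrable le_rfl hx)
    (hg.intervalIntegrable le_rfl hx), hf.eq_add_integral x hx, hg.eq_add_integral x hx]
  abel

theorem clm_comp [CompleteSpace E] [CompleteSpace F] (L : E →L[ℝ] F) (hf : HasACDeriv f f') :
    HasACDeriv (fun x => L (f x)) (fun x => L (f' x)) := by
  refine ⟨L.locallyIntegrableOn_comp hf.locallyIntegrableOn, fun x hx => ?_⟩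
  rw [L.intervalIntegral_comp_comm (hf.intervalIntegrable le_rfl hx), ← map_add,
    ← hf.eq_add_integral x hx]

theorem neg (hf : HasACDeriv f f') : HasACDeriv (fun x => -f x) (fun x => -f' x) := by
  refine ⟨hf.locallyIntegrableOn.neg, fun x hx => ?_⟩
  rw [intervalIntegral.integral_neg, ← neg_add, ← hf.eq_add_integral x hx]

theorem sub (hf : HasACDeriv f f') (hg : HasACDeriv g g') :
    HasACDeriv (fun x => f x - g x) (fun x => f' x - g' x) := by
  simpa only [sub_eq_add_neg] using hf.add hg.neg

theorem absolutelyContinuous (hf : HasACDeriv f f') {b : ℝ} (hb : 0 ≤ b) :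
    AbsolutelyContinuousOnInterval f 0 b := by
  have hnorm := (hf.intervalIntegrable le_rfl hb).norm
  refine absolutelyContinuousOnInterval_of_dist_le (C := 1)
    (hnorm.absolutelyContinuousOnInterval_intervalIntegral left_mem_uIcc) fun x hx y hy => ?_
  rw [uIcc_of_le hb] at hx hy
  have hx' := (hf.intervalIntegrable le_rfl hx.1).norm
  have hy' := (hf.intervalIntegrable le_rfl hy.1).norm
  rw [dist_eq_norm, dist_eq_norm, one_mul, ← hf.integral_eq_sub hy.1 hx.1,
    intervalIntegral.integral_interval_sub_left hx' hy']
  exact intervalIntegral.norm_integral_le_abs_integral_norm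

theorem continuousOn (hf : HasACDeriv f f') : ContinuousOn f (Ici 0) := by
  refine continuousOn_Ici_of_forall_Icc fun b hb => ?_
  simpa only [uIcc_of_le hb] using (hf.absolutelyContinuous hb).continuousOn

theorem ae_hasDerivAt [CompleteSpace E] (hf : HasACDeriv f f') :
    ∀ᵐ x ∂halfLine, HasDerivAt f (f' x) x := by
  have hloc : ∀ n : ℕ, ∀ᵐ x, x ∈ uIcc (0 : ℝ) n → ∀ c ∈ uIcc (0 : ℝ) n,
      HasDerivAt (fun x => ∫ t in c..x, f' t) (f' x) x := fun n =>
    (hf.intervalIntegrable le_rfl n.cast_nonneg).ae_hasDerivAt_integral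
  rw [ae_halfLine_iff]
  filter_upwards [ae_all_iff.2 hloc] with x hx hpos
  obtain ⟨n, hn⟩ := exists_nat_ge x
  have hmem : x ∈ uIcc (0 : ℝ) n := by
    rw [uIcc_of_le n.cast_nonneg]
    exact ⟨hpos.le, hn⟩
  refine ((hx n hmem 0 left_mem_uIcc).const_add (f 0)).congr_of_eventuallyEq ?_
  filter_upwards [Ioi_mem_nhds hpos] with t ht using hf.eq_add_integral t (le_of_lt ht)

theorem of_absolutelyContinuous [CompleteSpace E]
    (hac : ∀ b, 0 ≤ b → AbsolutelyContinuousOnInterval f 0 b)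
    (hderiv : ∀ᵐ x ∂halfLine, HasDerivAt f (f' x) x) (hf' : LocallyIntegrableOn f' (Ici 0)) :
    HasACDeriv f f' := by
  refine ⟨hf', fun x hx => ?_⟩
  have hprim := HasACDeriv.primitive hf' 0
  have hderiv0 : ∀ᵐ t, t ∈ uIcc 0 x →
      HasDerivAt (f - fun t => 0 + ∫ r in (0 : ℝ)..t, f' r) 0 t := by
    filter_upwards [ae_halfLine_iff.1 (hderiv.and hprim.ae_hasDerivAt), Measure.ae_ne volume 0]
      with t ht hne hmem
    rw [uIcc_of_le hx] at hmem
    obtain ⟨h1, h2⟩ := ht (lt_of_le_of_ne hmem.1 hne.symm)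
    simpa using h1.sub h2
  obtain ⟨C, hC⟩ := ((hac x hx).sub (hprim.absolutelyContinuous hx)).const_of_ae_hasDerivAt_zero
    hderiv0
  have h0 := hC 0 left_mem_uIcc
  have h1 := hC x right_mem_uIcc
  simp only [Pi.sub_apply, intervalIntegral.integral_same, sub_zero, zero_add] at h0 h1
  rw [h0, ← h1, sub_add_cancel]

theorem eq_of_ae_eq_zero (hf : HasACDeriv f f') (h : f' =ᵐ[halfLine] 0) {x : ℝ} (hx : 0 ≤ x) :
    f x = f 0 := by
  simpa using (hf.congr_deriv h).eq_add_integral x hx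

theorem indicator_Iic (hf : HasACDeriv f f') {N : ℝ} (hN : 0 ≤ N) (h0 : f N = 0) :
    HasACDeriv ((Iic N).indicator f) ((Iic N).indicator f') := by
  refine ⟨locallyIntegrableOn_Ici_iff.2 fun b hb => ?_, fun x hx => ?_⟩
  · rw [intervalIntegrable_iff]
    exact (intervalIntegrable_iff.1 (hf.intervalIntegrable le_rfl hb)).indicator measurableSet_Iic
  · rw [indicator_of_mem (show (0 : ℝ) ∈ Iic N from hN)]
    rcases le_or_gt x N with hxN | hxN
    · rw [indicator_of_mem (show x ∈ Iic N from hxN), hf.eq_add_integral x hx]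
      congr 1
      refine intervalIntegral.integral_congr fun t ht => ?_
      rw [uIcc_of_le hx] at ht
      exact (indicator_of_mem (show t ∈ Iic N from ht.2.trans hxN) _).symm
    · rw [indicator_of_notMem (show x ∉ Iic N from hxN.not_ge),
        show Iic N = {t | t ≤ N} from rfl, intervalIntegral.integral_indicator ⟨hN, hxN.le⟩,
        ← hf.eq_add_integral N hN, h0]

end Banach

section Ring

variable {A : Type*} [NormedRing A] [NormMulClass A] [NormedAlgebra ℝ A] [CompleteSpace A]
  {f f' g g' : ℝ → A}

theorem mul (hf : HasACDeriv f f') (hg : HasACDeriv g g') :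
    HasACDeriv (fun x => f x * g x) (fun x => f' x * g x + f x * g' x) := by
  refine of_absolutelyContinuous
    (fun b hb => (hf.absolutelyContinuous hb).smul (hg.absolutelyContinuous hb)) ?_ ?_
  · filter_upwards [hf.ae_hasDerivAt, hg.ae_hasDerivAt] with x hfx hgx using hfx.mul hgx
  · exact (hf.locallyIntegrableOn.mul_continuousOn hg.continuousOn
      isClosed_Ici.isLocallyClosed).add (hg.locallyIntegrableOn.continuousOn_mul hf.continuousOn
      isClosed_Ici.isLocallyClosed)

end Ring

section Real

variable {f f' : ℝ → ℝ}

theorem comp (hf : HasACDeriv f f') (φ : ℝ → ℝ)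
    (hφ : ∀ x, 0 ≤ x → ContDiffAt ℝ 1 φ (f x)) :
    HasACDeriv (fun x => φ (f x)) (fun x => deriv φ (f x) * f' x) := by
  refine of_absolutelyContinuous (fun b hb => ?_) ?_ ?_
  · have hlip : LocallyLipschitzOn (f '' Icc 0 b) φ := by
      rintro _ ⟨x, hx, rfl⟩
      obtain ⟨K, t, ht, hK⟩ := (hφ x hx.1).exists_lipschitzOnWith
      exact ⟨K, t, mem_nhdsWithin_of_mem_nhds ht, hK⟩
    obtain ⟨K, hK⟩ := hlip.exists_lipschitzOnWith_of_compact
      (isCompact_Icc.image_of_continuousOn (hf.continuousOn.mono Icc_subset_Ici_self))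
    refine absolutelyContinuousOnInterval_of_dist_le (C := K) (hf.absolutelyContinuous hb)
      fun x hx y hy => ?_
    rw [uIcc_of_le hb] at hx hy
    exact hK.dist_le_mul _ (mem_image_of_mem _ hx) _ (mem_image_of_mem _ hy)
  · filter_upwards [hf.ae_hasDerivAt, ae_pos_halfLine] with x hx hpos
    exact ((hφ x hpos.le).differentiableAt one_ne_zero).hasDerivAt.comp x hx
  · refine hf.locallyIntegrableOn.continuousOn_mul (fun x hx => ?_) isClosed_Ici.isLocallyClosed
    exact ContinuousAt.comp_continuousWithinAt (g := deriv φ)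
      (((hφ x hx).continuousAt_fderiv one_ne_zero).clm_apply continuousAt_const)
      (hf.continuousOn x hx)

theorem inv (hf : HasACDeriv f f') (h0 : ∀ x, 0 ≤ x → f x ≠ 0) :
    HasACDeriv (fun x => (f x)⁻¹) (fun x => -(f' x * (f x)⁻¹ ^ 2)) := by
  refine (hf.comp _ fun x hx => contDiffAt_inv ℝ (h0 x hx)).congr_deriv (.of_forall fun x => ?_)
  simp only [deriv_inv, inv_pow]
  ring

theorem sqrt (hf : HasACDeriv f f') (h0 : ∀ x, 0 ≤ x → f x ≠ 0) :
    HasACDeriv (fun x => √(f x)) (fun x => f' x / 2 * (√(f x))⁻¹) := by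
  refine (hf.comp _ fun x hx => Real.contDiffAt_sqrt (h0 x hx)).congr_deriv ?_
  filter_upwards [ae_restrict_mem measurableSet_Ici] with x hx
  rw [(Real.hasDerivAt_sqrt (h0 x hx)).deriv]
  ring

theorem id : HasACDeriv (fun x : ℝ => x) (fun _ => 1) :=
  ⟨locallyIntegrableOn_const 1, fun x _ => by simp⟩

theorem of_contDiff {φ : ℝ → ℝ} (hφ : ContDiff ℝ 1 φ) : HasACDeriv φ (deriv φ) := by
  simpa only [mul_one] using HasACDeriv.id.comp φ fun x _ => hφ.contDiffAt

end Real

end HasACDeriv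

section LinearODE

open scoped Nat

variable {E : Type*} [NormedAddCommGroup E] [NormedSpace ℝ E] {A : ℝ → E →L[ℝ] E}

theorem locallyIntegrableOn_clm_apply (hA : LocallyIntegrableOn A (Ici 0)) {u : ℝ → E}
    (hu : ContinuousOn u (Ici 0)) : LocallyIntegrableOn (fun x => A x (u x)) (Ici 0) := by
  rw [locallyIntegrableOn_iff isClosed_Ici.isLocallyClosed] at hA ⊢
  intro k hk hk'
  obtain ⟨C, hC⟩ := hk'.exists_bound_of_continuousOn (hu.mono hk)
  exact (ContinuousLinearMap.id ℝ (E →L[ℝ] E)).integrable_of_bilin_of_bdd_right C (hA k hk hk')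
    ((hu.mono hk).aestronglyMeasurable_of_isCompact hk' hk'.measurableSet)
    (ae_restrict_of_forall_mem hk'.measurableSet hC)

/-- The terms of the Picard (Neumann) series `∑ₙ pₙ` for the Cauchy problem `u' = A u`, `u(0) = u₀`:
`p₀ = u₀` and `pₙ₊₁(x) = ∫₀ˣ A pₙ`. -/
noncomputable def picardTerm (A : ℝ → E →L[ℝ] E) (u₀ : E) : ℕ → ℝ → E
  | 0 => fun _ => u₀
  | n + 1 => fun x => ∫ t in (0 : ℝ)..x, A t (picardTerm A u₀ n t)

theorem continuousOn_picardTerm (hA : LocallyIntegrableOn A (Ici 0)) (u₀ : E) (n : ℕ) :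
    ContinuousOn (picardTerm A u₀ n) (Ici 0) := by
  induction n with
  | zero => exact continuousOn_const
  | succ n ih =>
    simpa only [zero_add, picardTerm] using
      (HasACDeriv.primitive (locallyIntegrableOn_clm_apply hA ih) 0).continuousOn

theorem HasACDeriv.pow_div_factorial {f f' : ℝ → ℝ} (hf : HasACDeriv f f') (n : ℕ) :
    HasACDeriv (fun x => f x ^ (n + 1) / (n + 1)!) (fun x => f' x * (f x ^ n / n !)) := by
  have hderiv (t : ℝ) : HasDerivAt (fun t : ℝ => t ^ (n + 1) / (n + 1)!) (t ^ n / n !) t := by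
    refine ((hasDerivAt_pow (n + 1) t).div_const _).congr_deriv ?_
    push_cast [Nat.factorial_succ]
    field_simp
  refine (hf.comp (fun t => t ^ (n + 1) / (n + 1)!) fun x _ =>
    ((contDiff_id.pow _).div_const _).contDiffAt).congr_deriv ?_
  filter_upwards with x
  rw [(hderiv (f x)).deriv, mul_comm]

theorem norm_picardTerm_le (hA : LocallyIntegrableOn A (Ici 0)) (u₀ : E) (n : ℕ) {x : ℝ}
    (hx : 0 ≤ x) : ‖picardTerm A u₀ n x‖ ≤ ‖u₀‖ * ((∫ t in (0 : ℝ)..x, ‖A t‖) ^ n / n !) := by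
  have hK := HasACDeriv.primitive hA.norm 0
  simp only [zero_add] at hK
  induction n generalizing x with
  | zero => simp [picardTerm]
  | succ n ih =>
    have hpow := hK.pow_div_factorial n
    calc ‖picardTerm A u₀ (n + 1) x‖
        ≤ ∫ t in (0 : ℝ)..x, ‖u₀‖ * (‖A t‖ * ((∫ r in (0 : ℝ)..t, ‖A r‖) ^ n / n !)) := by
          refine intervalIntegral.norm_integral_le_of_norm_le hx (ae_of_all _ fun t ht => ?_)
            ((hpow.intervalIntegrable le_rfl hx).const_mul _)
          exact ((A t).le_opNorm_of_le (ih ht.1.le)).trans_eq (by ring)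
      _ = ‖u₀‖ * ((∫ t in (0 : ℝ)..x, ‖A t‖) ^ (n + 1) / (n + 1)!) := by
          rw [intervalIntegral.integral_const_mul, hpow.integral_eq_sub le_rfl hx]
          simp

theorem norm_picardTerm_le_of_le (hA : LocallyIntegrableOn A (Ici 0)) (u₀ : E) (n : ℕ) {x b : ℝ}
    (hx : 0 ≤ x) (hxb : x ≤ b) :
    ‖picardTerm A u₀ n x‖ ≤ ‖u₀‖ * ((∫ t in (0 : ℝ)..b, ‖A t‖) ^ n / n !) := by
  refine (norm_picardTerm_le hA u₀ n hx).trans ?_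
  gcongr
  · exact intervalIntegral.integral_nonneg hx fun t _ => norm_nonneg _
  · exact intervalIntegral.integral_mono_interval le_rfl hx hxb (ae_of_all _ fun t => norm_nonneg _)
      (intervalIntegrable_of_locallyIntegrableOn_Ici hA.norm le_rfl (hx.trans hxb))

variable [CompleteSpace E]

theorem hasSum_picardTerm (hA : LocallyIntegrableOn A (Ici 0)) (u₀ : E) {x : ℝ} (hx : 0 ≤ x) :
    HasSum (fun n => picardTerm A u₀ n x) (∑' n, picardTerm A u₀ n x) :=
  (Summable.of_norm_bounded ((Real.summable_pow_div_factorial _).mul_left _)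
    fun n => norm_picardTerm_le hA u₀ n hx).hasSum

theorem continuousOn_tsum_picardTerm (hA : LocallyIntegrableOn A (Ici 0)) (u₀ : E) :
    ContinuousOn (fun x => ∑' n, picardTerm A u₀ n x) (Ici 0) := by
  refine continuousOn_Ici_of_forall_Icc fun b _ => ?_
  exact continuousOn_tsum
    (fun n => (continuousOn_picardTerm hA u₀ n).mono Icc_subset_Ici_self)
    ((Real.summable_pow_div_factorial _).mul_left _)
    fun n t ht => norm_picardTerm_le_of_le hA u₀ n ht.1 ht.2

theorem exists_hasACDeriv_linear (hA : LocallyIntegrableOn A (Ici 0)) (u₀ : E) :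
    ∃ u : ℝ → E, HasACDeriv u (fun x => A x (u x)) ∧ u 0 = u₀ := by
  have hu0 : ∑' n, picardTerm A u₀ n 0 = u₀ := by
    rw [tsum_eq_single 0 fun n hn => ?_]
    · rfl
    · obtain ⟨k, rfl⟩ := Nat.exists_eq_succ_of_ne_zero hn
      exact intervalIntegral.integral_same
  refine ⟨fun x => ∑' n, picardTerm A u₀ n x,
    ⟨locallyIntegrableOn_clm_apply hA (continuousOn_tsum_picardTerm hA u₀), fun x hx => ?_⟩, hu0⟩
  have hsum : HasSum (fun n => picardTerm A u₀ (n + 1) x)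
      (∫ t in (0 : ℝ)..x, A t (∑' n, picardTerm A u₀ n t)) := by
    set K := ∫ t in (0 : ℝ)..x, ‖A t‖
    refine intervalIntegral.hasSum_integral_of_dominated_convergence
      (fun n t => ‖A t‖ * (‖u₀‖ * (K ^ n / n !))) (fun n => ?_)
      (fun n => ae_of_all _ fun t ht => ?_)
      (ae_of_all _ fun t _ => ((Real.summable_pow_div_factorial _).mul_left _).mul_left _) ?_
      (ae_of_all _ fun t ht => ?_)
    · exact (intervalIntegrable_of_locallyIntegrableOn_Ici (locallyIntegrableOn_clm_apply hA
        (continuousOn_picardTerm hA u₀ n)) le_rfl hx).aestronglyMeasurable_restrict_uIoc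
    · rw [uIoc_of_le hx] at ht
      exact (A t).le_opNorm_of_le (norm_picardTerm_le_of_le hA u₀ n ht.1.le ht.2)
    · simp only [tsum_mul_left]
      exact (intervalIntegrable_of_locallyIntegrableOn_Ici hA.norm le_rfl hx).mul_const _
    · rw [uIoc_of_le hx] at ht
      exact (hasSum_picardTerm hA u₀ ht.1.le).mapL (A t)
  rw [hu0, (hasSum_picardTerm hA u₀ hx).summable.tsum_eq_zero_add, hsum.tsum_eq]
  rfl

end LinearODE

section SquareIntegrable

theorem memLp_restrict_Icc_of_continuousOn_Ici {E : Type*} [NormedAddCommGroup E] {f : ℝ → E}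
    (hf : ContinuousOn f (Ici 0)) (p : ENNReal) (b : ℝ) :
    MemLp f p (volume.restrict (Icc 0 b)) := by
  have hc : ContinuousOn f (Icc 0 b) := hf.mono Icc_subset_Ici_self
  obtain ⟨C, hC⟩ := isCompact_Icc.exists_bound_of_continuousOn hc
  exact MemLp.of_bound (hc.aestronglyMeasurable_of_isCompact isCompact_Icc measurableSet_Icc) C
    (ae_restrict_of_forall_mem measurableSet_Icc hC)

namespace MemL2Loc

theorem of_continuousOn {E : Type*} [NormedAddCommGroup E] {f : ℝ → E}
    (hf : ContinuousOn f (Ici 0)) : MemL2Loc f :=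
  memLp_restrict_Icc_of_continuousOn_Ici hf 2

theorem congr {E : Type*} [NormedAddCommGroup E] {f g : ℝ → E} (hf : MemL2Loc f)
    (h : f =ᵐ[halfLine] g) : MemL2Loc g := fun b =>
  (hf b).ae_eq (ae_restrict_of_ae_restrict_of_subset Icc_subset_Ici_self h)

theorem add {E : Type*} [NormedAddCommGroup E] {f g : ℝ → E} (hf : MemL2Loc f)
    (hg : MemL2Loc g) : MemL2Loc (fun x => f x + g x) := fun b => (hf b).add (hg b)

theorem locallyIntegrableOn {E : Type*} [NormedAddCommGroup E] {f : ℝ → E} (hf : MemL2Loc f) :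
    LocallyIntegrableOn f (Ici 0) :=
  locallyIntegrableOn_Ici_iff.2 fun b hb =>
    (intervalIntegrable_iff_integrableOn_Icc_of_le hb).2 ((hf b).integrable one_le_two)

variable {A : Type*} [NormedRing A] {f g : ℝ → A}

theorem locallyIntegrableOn_mul (hf : MemL2Loc f) (hg : MemL2Loc g) :
    LocallyIntegrableOn (fun x => f x * g x) (Ici 0) :=
  locallyIntegrableOn_Ici_iff.2 fun b hb =>
    (intervalIntegrable_iff_integrableOn_Icc_of_le hb).2 ((hf b).integrable_mul (hg b))

theorem mul_continuousOn (hf : MemL2Loc f) (hg : ContinuousOn g (Ici 0)) :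
    MemL2Loc (fun x => f x * g x) := fun b =>
  (memLp_restrict_Icc_of_continuousOn_Ici hg ⊤ b).mul (hf b)

end MemL2Loc

end SquareIntegrable

section QuasiSolution

variable {𝕜 : Type*} [RCLike 𝕜]

/-- `y` solves `l(y) = v` on `[0, ∞)` for the generalized antiderivative `s`, with quasi-derivative
`y^{[1]} = z`; the equation is written as a first order system for the pair `(y, z)`. The scalars
may be real or complex. -/
structure IsQuasiSolution (s v y z : ℝ → 𝕜) : Prop where
  fst : HasACDeriv y (fun x => s x * y x + z x)
  snd : HasACDeriv z (fun x => -v x - s x * z x - s x ^ 2 * y x)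

theorem exists_isQuasiSolution_zero {s : ℝ → 𝕜} (hs : MemL2Loc s) (a b : 𝕜) :
    ∃ y z, IsQuasiSolution s 0 y z ∧ y 0 = a ∧ z 0 = b := by
  let p := ContinuousLinearMap.fst ℝ 𝕜 𝕜
  let q := ContinuousLinearMap.snd ℝ 𝕜 𝕜
  have hsmul {f : ℝ → 𝕜} (hf : LocallyIntegrableOn f (Ici 0)) (L : 𝕜 × 𝕜 →L[ℝ] 𝕜 × 𝕜) :=
    hf.smul_continuousOn (g := fun _ => L) isClosed_Ici.isLocallyClosed continuousOn_const
  have hA (L M K : 𝕜 × 𝕜 →L[ℝ] 𝕜 × 𝕜) :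
      LocallyIntegrableOn (fun x => s x • L + (s x * s x) • M + K) (Ici 0) :=
    ((hsmul hs.locallyIntegrableOn L).add (hsmul (hs.locallyIntegrableOn_mul hs) M)).add
      (locallyIntegrableOn_const K)
  obtain ⟨u, hu, hu0⟩ := exists_hasACDeriv_linear
    (hA (p.prod (-q)) ((0 : 𝕜 × 𝕜 →L[ℝ] 𝕜).prod (-p)) (q.prod 0)) (a, b)
  refine ⟨fun x => (u x).1, fun x => (u x).2, ⟨(hu.clm_comp p).congr_deriv ?_,
    (hu.clm_comp q).congr_deriv ?_⟩, congrArg Prod.fst hu0, congrArg Prod.snd hu0⟩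
  · filter_upwards with x
    simp [p, q]
  · filter_upwards with x
    simp only [add_apply, smul_apply, ContinuousLinearMap.prod_apply, ContinuousLinearMap.coe_fst',
      neg_apply, ContinuousLinearMap.coe_snd', Prod.smul_mk, smul_eq_mul, mul_neg, zero_apply,
      mul_zero, Prod.mk_add_mk, add_zero, Pi.zero_apply, neg_zero, zero_sub, q, p]
    ring

namespace IsQuasiSolution

variable {s v y z : ℝ → 𝕜}

theorem congr {s' v' : ℝ → 𝕜} (h : IsQuasiSolution s v y z) (hs : s =ᵐ[halfLine] s')
    (hv : v =ᵐ[halfLine] v') : IsQuasiSolution s' v' y z := by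
  constructor
  · refine h.fst.congr_deriv ?_
    filter_upwards [hs] with x hx
    rw [hx]
  · refine h.snd.congr_deriv ?_
    filter_upwards [hs, hv] with x hx hx'
    rw [hx, hx']

theorem memL2Loc_deriv (h : IsQuasiSolution s v y z) (hs : MemL2Loc s) :
    MemL2Loc (fun x => s x * y x + z x) :=
  (hs.mul_continuousOn h.fst.continuousOn).add (.of_continuousOn h.snd.continuousOn)

theorem wronskian {v₁ y₁ z₁ v₂ y₂ z₂ : ℝ → 𝕜} (h₁ : IsQuasiSolution s v₁ y₁ z₁)
    (h₂ : IsQuasiSolution s v₂ y₂ z₂) :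
    HasACDeriv (fun x => y₁ x * z₂ x - z₁ x * y₂ x) (fun x => v₁ x * y₂ x - y₁ x * v₂ x) := by
  refine ((h₁.fst.mul h₂.snd).sub (h₁.snd.mul h₂.fst)).congr_deriv (.of_forall fun x => ?_)
  ring

theorem add_antideriv (h : IsQuasiSolution s v y z) {r r' : ℝ → 𝕜} (hr : HasACDeriv r r') :
    IsQuasiSolution (fun x => s x + r x) (fun x => v x + r' x * y x) y
      (fun x => z x - r x * y x) := by
  constructor
  · refine h.fst.congr_deriv (.of_forall fun x => ?_)
    ring
  · refine (h.snd.sub (hr.mul h.fst)).congr_deriv (.of_forall fun x => ?_)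
    ring

theorem mul {g g' g'' : ℝ → 𝕜} (h : IsQuasiSolution s v y z) (hg : HasACDeriv g g')
    (hg' : HasACDeriv g' g'') :
    IsQuasiSolution s (fun x => v x * g x - 2 * (s x * y x + z x) * g' x - y x * g'' x)
      (fun x => y x * g x) (fun x => z x * g x + y x * g' x) := by
  constructor
  · refine (h.fst.mul hg).congr_deriv (.of_forall fun x => ?_)
    ring
  · refine ((h.snd.mul hg).add (h.fst.mul hg')).congr_deriv (.of_forall fun x => ?_)
    ring

theorem indicator_Iic (h : IsQuasiSolution s v y z) {N : ℝ} (hN : 0 ≤ N) (hy : y N = 0)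
    (hz : z N = 0) :
    IsQuasiSolution s ((Iic N).indicator v) ((Iic N).indicator y) ((Iic N).indicator z) := by
  constructor
  · refine (h.fst.indicator_Iic hN hy).congr_deriv (.of_forall fun x => ?_)
    by_cases hx : x ∈ Iic N <;> simp [hx]
  · refine (h.snd.indicator_Iic hN hz).congr_deriv (.of_forall fun x => ?_)
    by_cases hx : x ∈ Iic N <;> simp [hx]

theorem ofReal {s v y z : ℝ → ℝ} (h : IsQuasiSolution s v y z) :
    IsQuasiSolution (fun x => (s x : ℂ)) (fun x => (v x : ℂ)) (fun x => (y x : ℂ))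
      (fun x => (z x : ℂ)) := by
  constructor
  · simpa using h.fst.clm_comp Complex.ofRealCLM
  · simpa using h.snd.clm_comp Complex.ofRealCLM

end IsQuasiSolution

end QuasiSolution

section Semibounded

theorem mem_sector_zero_iff {m : ℝ} {w : ℂ} : w ∈ sector 0 0 m ↔ w.im = 0 ∧ m ≤ w.re := by
  constructor
  · rintro ⟨r, hr, θ, hθ, rfl⟩
    simp [le_antisymm hθ.2 hθ.1, hr]
  · rintro ⟨him, hre⟩
    refine ⟨w.re - m, sub_nonneg.2 hre, 0, by simp, Complex.ext ?_ ?_⟩ <;> simp [him]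

theorem isSemibounded_iff_forall_graph {H : Type*} [NormedAddCommGroup H] [InnerProductSpace ℂ H]
    {T : H →ₗ.[ℂ] H} :
    IsSemibounded T ↔ ∃ m : ℝ, ∀ p ∈ T.graph,
      (inner ℂ p.1 p.2).im = 0 ∧ m * ‖p.1‖ ^ 2 ≤ (inner ℂ p.1 p.2).re := by
  refine exists_congr fun m => ⟨fun h p hp => ?_, fun h y hy => ?_⟩
  · obtain ⟨y, hy1, hy2⟩ := (LinearPMap.mem_graph_iff T).1 hp
    rw [← hy1, ← hy2]
    rcases eq_or_ne (y : H) 0 with h0 | h0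
    · simp [h0]
    have hn : 0 < ‖(y : H)‖ := norm_pos_iff.2 h0
    set c : ℝ := ‖(y : H)‖⁻¹ with hc
    have hunit : ‖((c : ℂ) • y : T.domain)‖ = 1 := by
      simp [norm_smul, hc, hn.ne']
    obtain ⟨him, hre⟩ := mem_sector_zero_iff.1 (h ((c : ℂ) • y) hunit)
    rw [T.map_smul, Submodule.coe_smul, inner_smul_left, inner_smul_right, Complex.conj_ofReal,
      ← mul_assoc, ← Complex.ofReal_mul] at him hre
    rw [Complex.im_ofReal_mul, mul_eq_zero_iff_left (by positivity)] at him
    rw [Complex.re_ofReal_mul] at hre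
    refine ⟨him, ?_⟩
    rw [hc, ← mul_inv, ← div_eq_inv_mul, le_div_iff₀ (by positivity)] at hre
    rwa [sq]
  · rw [mem_sector_zero_iff]
    simpa [hy] using h _ (T.mem_graph y)

end Semibounded

section MinimalSolution

/-- Data for an element `y` of the domain `𝒟₀` of the minimal operator: `l(y) = v` is locally square
integrable, and `y` and its quasi-derivative `z` vanish at `0` and at `N`. Only the values on
`[0, N]` matter, the element of `𝒟₀` being `y` extended by zero beyond `N`. -/
structure IsMinimalSolution {𝕜 : Type*} [RCLike 𝕜] (s : ℝ → 𝕜) (N : ℝ) (v y z : ℝ → 𝕜) : Prop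
    extends IsQuasiSolution s v y z where
  nonneg : 0 ≤ N
  memL2Loc : MemL2Loc v
  init : y 0 = 0
  quasi_init : z 0 = 0
  final : y N = 0
  quasi_final : z N = 0

/-- The form of the minimal operator constructed from `s` is real and bounded below by `m`. -/
def HasFormBound (s : ℝ → ℂ) (m : ℝ) : Prop :=
  ∀ N v y z, IsMinimalSolution s N v y z →
    (∫ x in (0 : ℝ)..N, starRingEnd ℂ (y x) * v x).im = 0 ∧
      m * ∫ x in (0 : ℝ)..N, ‖y x‖ ^ 2 ≤ (∫ x in (0 : ℝ)..N, starRingEnd ℂ (y x) * v x).re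

theorem memL2Loc_of_memLp_halfLine {E : Type*} [NormedAddCommGroup E] {f : ℝ → E}
    (hf : MemLp f 2 halfLine) : MemL2Loc f := fun _ =>
  hf.mono_measure (Measure.restrict_mono_set _ Icc_subset_Ici_self)

theorem MemL2Loc.memLp_indicator_Iic {E : Type*} [NormedAddCommGroup E] {f : ℝ → E}
    (hf : MemL2Loc f) (N : ℝ) : MemLp ((Iic N).indicator f) 2 halfLine := by
  rw [memLp_indicator_iff_restrict measurableSet_Iic, Measure.restrict_restrict measurableSet_Iic,
    inter_comm, Ici_inter_Iic]
  exact hf N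

theorem setIntegral_Ici_indicator_Iic {f : ℝ → ℂ} {N : ℝ} (hN : 0 ≤ N) :
    ∫ x, (Iic N).indicator f x ∂halfLine = ∫ x in (0 : ℝ)..N, f x := by
  rw [integral_indicator measurableSet_Iic, Measure.restrict_restrict measurableSet_Iic, inter_comm,
    Ici_inter_Iic, intervalIntegral.integral_of_le hN, integral_Icc_eq_integral_Ioc]

variable {s v y z : ℝ → ℂ}

theorem IsQuasiSolution.maximalPair (h : IsQuasiSolution s v y z) {f g : L2HalfLine}
    (hf : f =ᵐ[halfLine] y) (hg : g =ᵐ[halfLine] v) : MaximalPair s f g y z where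
  rep := hf
  ac _ hb := h.fst.absolutelyContinuous hb
  quasi_ac _ hb := h.snd.absolutelyContinuous hb
  quasi_eq := by
    filter_upwards [h.fst.ae_hasDerivAt] with x hx
    rw [quasiDeriv, hx.deriv, add_sub_cancel_left]
  expr_eq := by
    filter_upwards [hg, h.snd.ae_hasDerivAt] with x hgx hx
    rw [hgx, diffExpr, hx.deriv]
    ring

theorem MaximalPair.isQuasiSolution (hs : MemL2Loc s) {f g : L2HalfLine}
    (h : MaximalPair s f g y z) : IsQuasiSolution s g y z where
  fst := by
    refine .of_absolutelyContinuous h.ac ?_ ((hs.mul_continuousOn h.ac.continuousOn).add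
      (.of_continuousOn h.quasi_ac.continuousOn)).locallyIntegrableOn
    filter_upwards [h.ac.ae_differentiableAt, h.quasi_eq] with x hx hzx
    rw [hzx, quasiDeriv, add_sub_cancel]
    exact hx.hasDerivAt
  snd := by
    refine .of_absolutelyContinuous h.quasi_ac ?_ ?_
    · filter_upwards [h.quasi_ac.ae_differentiableAt, h.expr_eq] with x hx hgx
      refine hx.hasDerivAt.congr_deriv ?_
      rw [hgx, diffExpr]
      ring
    · simp only [sq]
      exact ((memL2Loc_of_memLp_halfLine (Lp.memLp g)).locallyIntegrableOn.neg.sub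
        (hs.mul_continuousOn h.quasi_ac.continuousOn).locallyIntegrableOn).sub
        ((hs.locallyIntegrableOn_mul hs).mul_continuousOn h.ac.continuousOn
          isClosed_Ici.isLocallyClosed)

theorem IsMinimalSolution.exists_mem_minimalGraph {N : ℝ} (h : IsMinimalSolution s N v y z) :
    ∃ p ∈ minimalGraph s, p.1 =ᵐ[halfLine] (Iic N).indicator y ∧
      p.2 =ᵐ[halfLine] (Iic N).indicator v := by
  have hy := (MemL2Loc.of_continuousOn h.fst.continuousOn).memLp_indicator_Iic N
  have hv := h.memL2Loc.memLp_indicator_Iic N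
  refine ⟨(hy.toLp _, hv.toLp _), ⟨(Iic N).indicator y, (Iic N).indicator z,
    (h.indicator_Iic h.nonneg h.final h.quasi_final).maximalPair hy.coeFn_toLp hv.coeFn_toLp,
    ?_, ?_, N, fun x hx _ => ?_⟩, hy.coeFn_toLp, hv.coeFn_toLp⟩
  · simp [h.init]
  · simp [h.quasi_init]
  · simp [hx]

theorem deriv_eq_zero_of_eqOn_Ioi {b : ℝ} (h : EqOn y 0 (Ioi b)) : EqOn (deriv y) 0 (Ioi b) := by
  intro x hx
  simpa using (h.eventuallyEq_of_mem (Ioi_mem_nhds hx)).deriv_eq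

theorem MaximalPair.eqOn_zero_Ioi {f g : L2HalfLine} (h : MaximalPair s f g y z) {b : ℝ}
    (hb : 0 ≤ b) (hy : EqOn y 0 (Ioi b)) :
    EqOn z 0 (Ioi b) ∧ ∀ᵐ x ∂halfLine, b < x → g x = 0 := by
  have hz : EqOn z 0 (Ioi b) := by
    refine Measure.eqOn_open_of_ae_eq (μ := volume) ?_ isOpen_Ioi
      (h.quasi_ac.continuousOn.mono fun x hx => hb.trans (le_of_lt hx)) continuousOn_const
    filter_upwards [ae_restrict_of_ae_restrict_of_subset (fun x hx => hb.trans (le_of_lt hx))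
      h.quasi_eq, ae_restrict_mem measurableSet_Ioi] with x hx hbx
    simp [hx, quasiDeriv, hy hbx, deriv_eq_zero_of_eqOn_Ioi hy hbx]
  refine ⟨hz, ?_⟩
  filter_upwards [h.expr_eq] with x hx hbx
  simp [hx, diffExpr, hy hbx, hz hbx, deriv_eq_zero_of_eqOn_Ioi hz hbx]

theorem exists_isMinimalSolution_of_mem_minimalGraph (hs : MemL2Loc s)
    {p : L2HalfLine × L2HalfLine} (hp : p ∈ minimalGraph s) :
    ∃ N v y z, IsMinimalSolution s N v y z ∧ p.1 =ᵐ[halfLine] (Iic N).indicator y ∧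
      p.2 =ᵐ[halfLine] (Iic N).indicator v := by
  obtain ⟨y, z, h⟩ := hp
  obtain ⟨b, hb⟩ := h.compact_supp
  set b' := max b 0
  have hb' : b' < b' + 1 := lt_add_one b'
  have hy : EqOn y 0 (Ioi b') := fun x hx =>
    hb x ((le_max_left b 0).trans_lt hx) ((le_max_right b 0).trans (le_of_lt hx))
  obtain ⟨hz, hg⟩ := h.toMaximalPair.eqOn_zero_Ioi (le_max_right b 0) hy
  refine ⟨b' + 1, p.2, y, z, ⟨h.toMaximalPair.isQuasiSolution hs, by positivity,
    memL2Loc_of_memLp_halfLine (Lp.memLp p.2), h.init, h.quasi_init, hy hb', hz hb'⟩, ?_, ?_⟩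
  · filter_upwards [h.rep] with x hx
    rw [hx, eq_comm, indicator_apply_eq_self]
    exact fun hx' => hy (hb'.trans (not_le.1 hx'))
  · filter_upwards [hg] with x hx
    rw [eq_comm, indicator_apply_eq_self]
    exact fun hx' => hx (hb'.trans (not_le.1 hx'))

theorem inner_L2HalfLine_eq_intervalIntegral {f g : L2HalfLine} {N : ℝ} (hN : 0 ≤ N)
    (hf : f =ᵐ[halfLine] (Iic N).indicator y) (hg : g =ᵐ[halfLine] (Iic N).indicator v) :
    inner ℂ f g = ∫ x in (0 : ℝ)..N, starRingEnd ℂ (y x) * v x := by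
  rw [L2.inner_def, ← setIntegral_Ici_indicator_Iic hN]
  refine integral_congr_ae ?_
  filter_upwards [hf, hg] with x h1 h2
  by_cases hx : x ∈ Iic N <;> simp [h1, h2, hx, mul_comm]

theorem norm_sq_L2HalfLine_eq_intervalIntegral {f : L2HalfLine} {N : ℝ} (hN : 0 ≤ N)
    (hf : f =ᵐ[halfLine] (Iic N).indicator y) : ‖f‖ ^ 2 = ∫ x in (0 : ℝ)..N, ‖y x‖ ^ 2 := by
  have h := inner_L2HalfLine_eq_intervalIntegral hN hf hf
  simp only [Complex.conj_mul', inner_self_eq_norm_sq_to_K, ← Complex.ofReal_pow,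
    intervalIntegral.integral_ofReal] at h
  exact Complex.ofReal_injective (by simpa using h)

theorem isSemibounded_minimalOperator_iff (hs : MemL2Loc s) :
    IsSemibounded (minimalOperator s) ↔ ∃ m, HasFormBound s m := by
  rw [isSemibounded_iff_forall_graph, minimalOperator_graph]
  refine exists_congr fun m => ⟨fun h N v y z hy => ?_, fun h p hp => ?_⟩
  · obtain ⟨p, hp, h1, h2⟩ := hy.exists_mem_minimalGraph
    rw [← inner_L2HalfLine_eq_intervalIntegral hy.nonneg h1 h2,
      ← norm_sq_L2HalfLine_eq_intervalIntegral hy.nonneg h1]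
    exact h p hp
  · obtain ⟨N, v, y, z, hy, h1, h2⟩ := exists_isMinimalSolution_of_mem_minimalGraph hs hp
    rw [inner_L2HalfLine_eq_intervalIntegral hy.nonneg h1 h2,
      norm_sq_L2HalfLine_eq_intervalIntegral hy.nonneg h1]
    exact h N v y z hy

end MinimalSolution

theorem HasACDeriv.integral_congr {E : Type*} [NormedAddCommGroup E] [NormedSpace ℝ E]
    {F p q : ℝ → E} (hF : HasACDeriv F (fun x => p x - q x)) (hp : LocallyIntegrableOn p (Ici 0))
    {N : ℝ} (hN : 0 ≤ N) (h : F N = F 0) :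
    ∫ x in (0 : ℝ)..N, p x = ∫ x in (0 : ℝ)..N, q x := by
  have hq : LocallyIntegrableOn q (Ici 0) := by
    convert hp.sub hF.locallyIntegrableOn using 1
    ext x
    simp
  have h0 := hF.integral_eq_sub le_rfl hN
  rwa [intervalIntegral.integral_sub (intervalIntegrable_of_locallyIntegrableOn_Ici hp le_rfl hN)
    (intervalIntegrable_of_locallyIntegrableOn_Ici hq le_rfl hN), h, sub_self, sub_eq_zero] at h0

section FormBound

open scoped ComplexConjugate

theorem HasACDeriv.conj {f f' : ℝ → ℂ} (hf : HasACDeriv f f') :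
    HasACDeriv (fun x => conj (f x)) (fun x => conj (f' x)) :=
  hf.clm_comp (Complex.conjCLE : ℂ →L[ℝ] ℂ)

variable {s v y z : ℝ → ℂ}

theorem IsQuasiSolution.hasACDeriv_mul_conj (h : IsQuasiSolution s v y z) :
    HasACDeriv (fun x => z x * conj (y x)) (fun x =>
      ‖s x * y x + z x‖ ^ 2 - conj (y x) * v x -
        s x * ((s x * y x + z x) * conj (y x) + y x * conj (s x * y x + z x))) := by
  refine (h.snd.mul h.fst.conj).congr_deriv (.of_forall fun x => ?_)
  simp only [← Complex.mul_conj', map_add, map_mul]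
  ring

theorem IsMinimalSolution.locallyIntegrableOn_conj_mul {N : ℝ} (h : IsMinimalSolution s N v y z) :
    LocallyIntegrableOn (fun x => conj (y x) * v x) (Ici 0) :=
  h.memL2Loc.locallyIntegrableOn.continuousOn_mul h.fst.conj.continuousOn
    isClosed_Ici.isLocallyClosed

theorem hasACDeriv_mul_add_integral_sq_add {γ : ℝ → ℝ} (hγ : MemL2Loc γ) (b : ℝ) (C : ℂ) :
    HasACDeriv (fun x => (b * x + (∫ t in (0 : ℝ)..x, γ t ^ 2 : ℝ) + C : ℂ))
      (fun x => (b + γ x ^ 2 : ℂ)) := by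
  have hint : HasACDeriv (fun x => 0 + ∫ t in (0 : ℝ)..x, γ t ^ 2) (fun x => γ x ^ 2) :=
    .primitive (by simpa only [sq] using hγ.locallyIntegrableOn_mul hγ) 0
  refine (((HasACDeriv.const b).mul .id).add hint |>.clm_comp Complex.ofRealCLM |>.add
    (.const C)).congr (fun x _ => ?_) (.of_forall fun x => ?_) <;> simp

theorem IsQuasiSolution.integral_conj_mul_eq {γ : ℝ → ℝ} {b N : ℝ}
    (h : IsQuasiSolution (fun x => (γ x : ℂ)) (fun x => v x - (b + γ x ^ 2) * y x) y z)
    (hN : 0 ≤ N) (h0 : y 0 = 0) (hyN : y N = 0) :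
    ∫ x in (0 : ℝ)..N, conj (y x) * v x =
      ((∫ x in (0 : ℝ)..N, (b * ‖y x‖ ^ 2 + ‖z x‖ ^ 2) : ℝ) : ℂ) := by
  have hyc := h.fst.continuousOn
  have hzc := h.snd.continuousOn
  rw [← intervalIntegral.integral_ofReal, eq_comm]
  refine (h.hasACDeriv_mul_conj.congr_deriv (.of_forall fun x => ?_)).integral_congr
    (ContinuousOn.locallyIntegrableOn (by fun_prop) measurableSet_Ici) hN ?_
  · push_cast [← Complex.mul_conj']
    simp only [map_add, map_mul, Complex.conj_ofReal]
    ring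
  · simp [h0, hyN]

theorem hasFormBound_of_ae_eq_add_integral_sq {γ : ℝ → ℝ} (hγ : MemL2Loc γ) {b : ℝ} {C : ℂ}
    (hs : ∀ᵐ x ∂halfLine, s x = b * x + γ x + (∫ t in (0 : ℝ)..x, γ t ^ 2 : ℝ) + C) :
    HasFormBound s b := by
  intro N v y z h
  have hτ := (hasACDeriv_mul_add_integral_sq_add hγ b C).neg
  set τ : ℝ → ℂ := fun x => b * x + (∫ t in (0 : ℝ)..x, γ t ^ 2 : ℝ) + C
  have hγsol : IsQuasiSolution (fun x => (γ x : ℂ)) (fun x => v x - (b + γ x ^ 2) * y x) y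
      (fun x => z x + τ x * y x) := by
    convert (h.toIsQuasiSolution.add_antideriv hτ).congr (s' := fun x => (γ x : ℂ)) ?_ .rfl using 1
    · ext x
      ring
    · ext x
      ring
    · filter_upwards [hs] with x hx
      rw [hx]
      ring
  have hy : ContinuousOn (fun x => b * ‖y x‖ ^ 2) (Icc 0 N) :=
    ((h.fst.continuousOn.norm.pow 2).const_smul b).mono Icc_subset_Ici_self
  have hz : ContinuousOn (fun x => ‖z x + τ x * y x‖ ^ 2) (Icc 0 N) :=
    (hγsol.snd.continuousOn.norm.pow 2).mono Icc_subset_Ici_self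
  rw [hγsol.integral_conj_mul_eq h.nonneg h.init h.final, Complex.ofReal_im, Complex.ofReal_re,
    ← intervalIntegral.integral_const_mul]
  exact ⟨rfl, intervalIntegral.integral_mono_on h.nonneg (hy.intervalIntegrable_of_Icc h.nonneg)
    ((hy.add hz).intervalIntegrable_of_Icc h.nonneg)
    fun x _ => le_add_of_nonneg_right (sq_nonneg _)⟩

end FormBound

section DuBoisReymond

open scoped ContDiff

/-- Real test functions on `(0, ∞)`. -/
structure IsTestFunction (φ : ℝ → ℝ) : Prop where
  contDiff : ContDiff ℝ ∞ φ
  hasCompactSupport : HasCompactSupport φ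
  tsupport_subset : tsupport φ ⊆ Ioi 0

theorem isTestFunction_contDiffBump {c : ℝ} (χ : ContDiffBump c) (hc : χ.rOut < c) :
    IsTestFunction χ where
  contDiff := χ.contDiff
  hasCompactSupport := χ.hasCompactSupport
  tsupport_subset := by
    rw [χ.tsupport_eq, Real.closedBall_eq_Icc]
    exact fun x hx => (sub_pos.2 hc).trans_le hx.1

namespace IsTestFunction

variable {φ ψ : ℝ → ℝ}

theorem exists_tsupport_subset_Icc (hφ : IsTestFunction φ) :
    ∃ a b, 0 < a ∧ a < b ∧ tsupport φ ⊆ Icc a b := by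
  rcases (tsupport φ).eq_empty_or_nonempty with h | h
  · exact ⟨1, 2, one_pos, one_lt_two, h ▸ empty_subset _⟩
  obtain ⟨a, ha, hmin⟩ := hφ.hasCompactSupport.exists_isLeast h
  obtain ⟨b, -, hmax⟩ := hφ.hasCompactSupport.exists_isGreatest h
  exact ⟨a, b + 1, hφ.tsupport_subset ha, by linarith [hmax ha],
    fun x hx => ⟨hmin hx, by linarith [hmax hx]⟩⟩

theorem hasACDeriv (hφ : IsTestFunction φ) : HasACDeriv φ (deriv φ) :=
  .of_contDiff (hφ.contDiff.of_le (by simp))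

theorem deriv (hφ : IsTestFunction φ) : IsTestFunction (deriv φ) where
  contDiff := (contDiff_infty_iff_deriv.1 hφ.contDiff).2
  hasCompactSupport := hφ.hasCompactSupport.deriv
  tsupport_subset := tsupport_deriv_subset.trans hφ.tsupport_subset

theorem add (hφ : IsTestFunction φ) (hψ : IsTestFunction ψ) : IsTestFunction (φ + ψ) where
  contDiff := hφ.contDiff.add hψ.contDiff
  hasCompactSupport := hφ.hasCompactSupport.add hψ.hasCompactSupport
  tsupport_subset := (tsupport_add φ ψ).trans (union_subset hφ.tsupport_subset hψ.tsupport_subset)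

theorem const_smul (hφ : IsTestFunction φ) (c : ℝ) : IsTestFunction (c • φ) where
  contDiff := hφ.contDiff.const_smul c
  hasCompactSupport := hφ.hasCompactSupport.smul_left (f := fun _ => c)
  tsupport_subset := (tsupport_smul_subset_right (fun _ => c) φ).trans hφ.tsupport_subset

theorem exists_deriv_eq (hφ : IsTestFunction φ) (h : ∫ x, φ x = 0) :
    ∃ Φ, IsTestFunction Φ ∧ _root_.deriv Φ = φ := by
  obtain ⟨a, b, ha, -, hab⟩ := hφ.exists_tsupport_subset_Icc
  have hzero {x : ℝ} (hx : x ∉ Icc a b) : φ x = 0 :=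
    image_eq_zero_of_notMem_tsupport fun hx' => hx (hab hx')
  have hcont := hφ.contDiff.continuous
  have hint : Integrable φ := hcont.integrable_of_hasCompactSupport hφ.hasCompactSupport
  set Φ : ℝ → ℝ := fun x => ∫ t in Iic x, φ t
  have hΦ : ∀ x, HasDerivAt Φ (φ x) x := fun x => by
    have := intervalIntegral.integral_hasDerivAt_right (hcont.intervalIntegrable 0 x)
      (hcont.stronglyMeasurableAtFilter _ _) hcont.continuousAt
    refine (this.add_const (∫ t in Iic 0, φ t)).congr_of_eventuallyEq (.of_forall fun x => ?_)
    exact eq_add_of_sub_eq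
      (intervalIntegral.integral_Iic_sub_Iic hint.integrableOn hint.integrableOn)
  have hderiv : _root_.deriv Φ = φ := funext fun x => (hΦ x).deriv
  have hsupport : Function.support Φ ⊆ Icc a b := by
    refine fun x hx => ⟨?_, ?_⟩ <;> by_contra! hlt <;> refine hx ?_
    · exact setIntegral_eq_zero_of_forall_eq_zero fun t ht => hzero fun h' =>
        (h'.1.trans ht).not_gt hlt
    · exact (setIntegral_eq_integral_of_forall_compl_eq_zero fun t ht => hzero fun h' =>
        ht (h'.2.trans hlt.le)).trans h
  have htsupport : tsupport Φ ⊆ Icc a b := closure_minimal hsupport isClosed_Icc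
  refine ⟨Φ, ⟨contDiff_infty_iff_deriv.2 ⟨fun x => (hΦ x).differentiableAt, hderiv ▸ hφ.contDiff⟩,
    isCompact_Icc.of_isClosed_subset (isClosed_tsupport _) htsupport,
    htsupport.trans fun x hx => ha.trans_le hx.1⟩, hderiv⟩

theorem exists_integral_eq_one : ∃ φ, IsTestFunction φ ∧ ∫ x, φ x = 1 := by
  let χ : ContDiffBump (2 : ℝ) := ⟨1 / 2, 1, by norm_num, by norm_num⟩
  refine ⟨_, (isTestFunction_contDiffBump χ one_lt_two).const_smul (∫ x, χ x)⁻¹, ?_⟩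
  simp only [Pi.smul_apply, smul_eq_mul]
  rw [integral_const_mul, inv_mul_cancel₀ (χ.integral_pos (μ := volume)).ne']

theorem integrable_smul {E : Type*} [NormedAddCommGroup E] [NormedSpace ℝ E]
    (hφ : IsTestFunction φ) {F : ℝ → E} (hF : LocallyIntegrableOn F (Ici 0)) :
    Integrable (fun x => φ x • F x) := by
  rw [← integrableOn_iff_integrable_of_support_subset
    (show Function.support (fun x => φ x • F x) ⊆ tsupport φ from
      (Function.support_smul_subset_left φ F).trans (subset_tsupport φ))]
  exact (hF.integrableOn_compact_subset (hφ.tsupport_subset.trans Ioi_subset_Ici_self)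
    hφ.hasCompactSupport).continuousOn_smul hφ.contDiff.continuous.continuousOn
    hφ.hasCompactSupport

theorem integral_deriv_mul_eq (hφ : IsTestFunction φ) {F F' : ℝ → ℝ} (hF : HasACDeriv F F') :
    ∫ x, _root_.deriv φ x * F x = -∫ x, φ x * F' x := by
  obtain ⟨a, b, ha, hab, hsupp⟩ := hφ.exists_tsupport_subset_Icc
  have hN : 0 ≤ b + 1 := by linarith
  have hIoc : tsupport φ ⊆ Ioc 0 (b + 1) := hsupp.trans fun x hx =>
    ⟨ha.trans_le hx.1, hx.2.trans (by linarith)⟩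
  have h0 : φ 0 = 0 := image_eq_zero_of_notMem_tsupport fun h => (hIoc h).1.false
  have hb : φ (b + 1) = 0 := image_eq_zero_of_notMem_tsupport fun h => by linarith [(hsupp h).2]
  have hprod := (hφ.hasACDeriv.mul hF).congr_deriv
    (g' := fun x => _root_.deriv φ x * F x - -(φ x * F' x)) (.of_forall fun x => by ring)
  have hloc : LocallyIntegrableOn (fun x => _root_.deriv φ x * F x) (Ici 0) :=
    (hφ.deriv.contDiff.continuous.continuousOn.mul hF.continuousOn).locallyIntegrableOn
      measurableSet_Ici
  have hparts := hprod.integral_congr hloc hN (by rw [h0, hb, zero_mul, zero_mul])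
  rw [intervalIntegral.integral_neg] at hparts
  rwa [intervalIntegral.integral_eq_integral_of_support_subset,
    intervalIntegral.integral_eq_integral_of_support_subset] at hparts
  · exact (Function.support_mul_subset_left φ F').trans ((subset_tsupport φ).trans hIoc)
  · exact (Function.support_mul_subset_left (_root_.deriv φ) F).trans
      (support_deriv_subset.trans hIoc)

end IsTestFunction

theorem exists_ae_eq_const_of_integral_deriv_smul_eq_zero {E : Type*} [NormedAddCommGroup E]
    [NormedSpace ℝ E] [CompleteSpace E] {F : ℝ → E} (hF : LocallyIntegrableOn F (Ici 0))
    (h : ∀ φ, IsTestFunction φ → ∫ x, deriv φ x • F x = 0) : ∃ c, ∀ᵐ x ∂halfLine, F x = c := by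
  obtain ⟨φ₀, hφ₀, hφ₀_one⟩ := IsTestFunction.exists_integral_eq_one
  set c := ∫ x, φ₀ x • F x
  have hFc : LocallyIntegrableOn (fun x => F x - c) (Ici 0) :=
    hF.sub (locallyIntegrableOn_const c)
  refine ⟨c, ae_halfLine_iff.2 ?_⟩
  simp only [← sub_eq_zero (b := c)]
  refine isOpen_Ioi.ae_eq_zero_of_integral_contDiff_smul_eq_zero
    (hFc.mono_set Ioi_subset_Ici_self) fun φ hsmooth hcompact hsupp => ?_
  have hφ : IsTestFunction φ := ⟨hsmooth, hcompact, hsupp⟩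
  have hint {ψ : ℝ → ℝ} (hψ : IsTestFunction ψ) : Integrable ψ :=
    hψ.contDiff.continuous.integrable_of_hasCompactSupport hψ.hasCompactSupport
  obtain ⟨Φ, hΦ, hderiv⟩ := (hφ.add (hφ₀.const_smul (-∫ x, φ x))).exists_deriv_eq (by
    simp only [Pi.add_apply, Pi.smul_apply, smul_eq_mul]
    rw [integral_add (hint hφ) ((hint hφ₀).const_mul _), integral_const_mul, hφ₀_one]
    ring)
  have h0 := h Φ hΦ
  simp only [hderiv, Pi.add_apply, Pi.smul_apply, add_smul, smul_assoc] at h0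
  rw [integral_add (hφ.integrable_smul hF)
    (by exact (hφ₀.integrable_smul hF).smul (-∫ x, φ x)), integral_smul] at h0
  simp only [smul_sub]
  rw [integral_sub (hφ.integrable_smul hF) ((hint hφ).smul_const c), integral_smul_const, ← h0,
    neg_smul, sub_eq_add_neg]

theorem exists_hasACDeriv_ae_eq_of_integral_deriv_mul_eq {q r : ℝ → ℝ}
    (hq : LocallyIntegrableOn q (Ici 0)) (hr : LocallyIntegrableOn r (Ici 0))
    (h : ∀ φ, IsTestFunction φ → ∫ x, deriv φ x * q x = -∫ x, φ x * r x) :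
    ∃ Q, HasACDeriv Q r ∧ q =ᵐ[halfLine] Q := by
  have hR := HasACDeriv.primitive hr 0
  set R : ℝ → ℝ := fun x => 0 + ∫ t in (0 : ℝ)..x, r t
  have hRloc := hR.continuousOn.locallyIntegrableOn measurableSet_Ici (μ := volume)
  obtain ⟨c, hc⟩ : ∃ c, ∀ᵐ x ∂halfLine, (q - R) x = c := by
    refine exists_ae_eq_const_of_integral_deriv_smul_eq_zero (hq.sub hRloc) fun φ hφ => ?_
    simp only [Pi.sub_apply, smul_sub]
    rw [integral_sub (hφ.deriv.integrable_smul hq) (hφ.deriv.integrable_smul hRloc), sub_eq_zero]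
    exact (h φ hφ).trans (hφ.integral_deriv_mul_eq hR).symm
  refine ⟨fun x => c + R x, ((HasACDeriv.const c).add hR).congr_deriv ?_, ?_⟩
  · exact .of_forall fun x => zero_add _
  · filter_upwards [hc] with x hx
    rw [← hx, Pi.sub_apply, sub_add_cancel]

end DuBoisReymond

section ImaginaryPart

open scoped ComplexConjugate

namespace IsTestFunction

variable {φ ψ : ℝ → ℝ}

theorem mul (hφ : IsTestFunction φ) (hψ : IsTestFunction ψ) : IsTestFunction (φ * ψ) where
  contDiff := hφ.contDiff.mul hψ.contDiff
  hasCompactSupport := hφ.hasCompactSupport.mul_right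
  tsupport_subset := (tsupport_mul_subset_left (f := φ) (g := ψ)).trans hφ.tsupport_subset

theorem exists_isTestFunction_mul_eq (hφ : IsTestFunction φ) :
    ∃ χ, IsTestFunction χ ∧ χ * φ = φ := by
  obtain ⟨a, b, ha, hab, hsupp⟩ := hφ.exists_tsupport_subset_Icc
  let χ : ContDiffBump ((a + b) / 2) := ⟨(b - a) / 2, b / 2, by linarith, by linarith⟩
  refine ⟨χ, isTestFunction_contDiffBump χ ?_, funext fun x => ?_⟩
  · change b / 2 < (a + b) / 2
    linarith
  · by_cases hx : x ∈ tsupport φ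
    · have hball : x ∈ Metric.closedBall ((a + b) / 2) ((b - a) / 2) := by
        rw [← Real.Icc_eq_closedBall]
        exact hsupp hx
      rw [Pi.mul_apply, χ.one_of_mem_closedBall hball, one_mul]
    · rw [Pi.mul_apply, image_eq_zero_of_notMem_tsupport hx, mul_zero]

theorem exists_eq_mul_self_sub_mul_self (hφ : IsTestFunction φ) :
    ∃ g h, IsTestFunction g ∧ IsTestFunction h ∧ φ = g * g - h * h := by
  obtain ⟨χ, hχ, hmul⟩ := hφ.exists_isTestFunction_mul_eq
  refine ⟨(1 / 2 : ℝ) • (χ + φ), (1 / 2 : ℝ) • (χ + (-1 : ℝ) • φ), (hχ.add hφ).const_smul _,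
    (hχ.add (hφ.const_smul _)).const_smul _, ?_⟩
  conv_lhs => rw [← hmul]
  ext x
  simp only [Pi.mul_apply, Pi.sub_apply, Pi.smul_apply, Pi.add_apply, smul_eq_mul]
  ring

theorem hasDerivAt (hφ : IsTestFunction φ) (x : ℝ) : HasDerivAt φ (_root_.deriv φ x) x :=
  (hφ.contDiff.differentiable (by simp) x).hasDerivAt

theorem integrable_mul_deriv_add_sq_mul (hφ : IsTestFunction φ) {q r : ℝ → ℝ}
    (hq : LocallyIntegrableOn q (Ici 0)) (hr : LocallyIntegrableOn r (Ici 0)) :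
    Integrable fun x => 2 * φ x * _root_.deriv φ x * q x + φ x ^ 2 * r x := by
  refine ((((hφ.mul hφ.deriv).const_smul 2).integrable_smul hq).add
    ((hφ.mul hφ).integrable_smul hr)).congr (.of_forall fun x => ?_)
  simp only [Pi.add_apply, Pi.smul_apply, Pi.mul_apply, smul_eq_mul]
  ring

end IsTestFunction

theorem exists_hasACDeriv_ae_eq_of_forall_mul_self {q r : ℝ → ℝ}
    (hq : LocallyIntegrableOn q (Ici 0)) (hr : LocallyIntegrableOn r (Ici 0))
    (h : ∀ g, IsTestFunction g → ∫ x, (2 * g x * deriv g x * q x + g x ^ 2 * r x) = 0) :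
    ∃ Q, HasACDeriv Q r ∧ q =ᵐ[halfLine] Q := by
  have hsq {g : ℝ → ℝ} (hg : IsTestFunction g) :
      ∫ x, deriv (g * g) x * q x = -∫ x, (g * g) x * r x := by
    rw [eq_neg_iff_add_eq_zero]
    refine (integral_add ((hg.mul hg).deriv.integrable_smul hq)
      ((hg.mul hg).integrable_smul hr)).symm.trans ((integral_congr_ae ?_).trans (h g hg))
    refine .of_forall fun x => ?_
    simp only [((hg.hasDerivAt x).mul (hg.hasDerivAt x)).deriv, Pi.mul_apply, smul_eq_mul]
    ring
  refine exists_hasACDeriv_ae_eq_of_integral_deriv_mul_eq hq hr fun φ hφ => ?_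
  obtain ⟨g, h, hg, hh, rfl⟩ := hφ.exists_eq_mul_self_sub_mul_self
  have hderiv (x : ℝ) : deriv (g * g - h * h) x = deriv (g * g) x - deriv (h * h) x :=
    (((hg.mul hg).hasDerivAt x).sub ((hh.mul hh).hasDerivAt x)).deriv
  simp only [hderiv, Pi.sub_apply, sub_mul]
  rw [integral_sub, integral_sub, hsq hg, hsq hh, neg_sub_neg, neg_sub]
  exacts [(hg.mul hg).integrable_smul hr, (hh.mul hh).integrable_smul hr,
    (hg.mul hg).deriv.integrable_smul hq, (hh.mul hh).deriv.integrable_smul hq]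

theorem IsQuasiSolution.hasACDeriv_norm_sq {s v y z : ℝ → ℂ} (h : IsQuasiSolution s v y z) :
    HasACDeriv (fun x => ‖y x‖ ^ 2) (fun x => 2 * ((s x * y x + z x) * conj (y x)).re) := by
  refine ((h.fst.mul h.fst.conj).clm_comp Complex.reCLM).congr (fun x _ => ?_)
    (.of_forall fun x => ?_)
  · simp only [Complex.reCLM_apply, Complex.mul_conj', ← Complex.ofReal_pow, Complex.ofReal_re]
  · simp only [Complex.reCLM_apply, Complex.add_re, Complex.mul_re, Complex.conj_re,
      Complex.conj_im]
    ring

theorem IsMinimalSolution.integral_im_mul_eq_zero {s v y z : ℝ → ℂ} {N : ℝ}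
    (h : IsMinimalSolution s N v y z) (him : (∫ x in (0 : ℝ)..N, conj (y x) * v x).im = 0) :
    ∫ x in (0 : ℝ)..N, (s x).im * (2 * ((s x * y x + z x) * conj (y x)).re) = 0 := by
  have hvy := h.locallyIntegrableOn_conj_mul
  have hint := intervalIntegrable_of_locallyIntegrableOn_Ici hvy le_rfl h.nonneg
  have hform : HasACDeriv (fun x => (z x * conj (y x)).im) (fun x => -(conj (y x) * v x).im -
      (s x).im * (2 * ((s x * y x + z x) * conj (y x)).re)) := by
    refine (h.hasACDeriv_mul_conj.clm_comp Complex.imCLM).congr_deriv (.of_forall fun x => ?_)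
    simp only [Complex.imCLM_apply, ← Complex.ofReal_pow, Complex.sub_im, Complex.ofReal_im,
      Complex.add_im, Complex.mul_im, Complex.mul_re, Complex.add_re, Complex.conj_re,
      Complex.conj_im]
    ring
  rw [← hform.integral_congr (Complex.imCLM.locallyIntegrableOn_comp hvy).neg h.nonneg
    (by simp [h.init, h.final]), intervalIntegral.integral_neg, neg_eq_zero]
  exact (Complex.imCLM.intervalIntegral_comp_comm hint).trans him

theorem IsQuasiSolution.memL2Loc_deriv_norm_sq {s v y z : ℝ → ℂ} (h : IsQuasiSolution s v y z)
    (hs : MemL2Loc s) : MemL2Loc fun x => 2 * ((s x * y x + z x) * conj (y x)).re := fun b =>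
  ((h.memL2Loc_deriv hs).mul_continuousOn h.fst.conj.continuousOn b).re.const_mul 2

theorem IsQuasiSolution.exists_isMinimalSolution_mul {s u w : ℝ → ℂ} (hs : MemL2Loc s)
    (hu : IsQuasiSolution s 0 u w) {g : ℝ → ℝ} (hg : IsTestFunction g) :
    ∃ N v, Function.support g ⊆ Ioc 0 N ∧
      IsMinimalSolution s N v (fun x => u x * g x) (fun x => w x * g x + u x * deriv g x) := by
  obtain ⟨a, b, ha, hab, hsupp⟩ := hg.exists_tsupport_subset_Icc
  have hzero {x : ℝ} (hx : x ∉ Icc a b) : g x = 0 ∧ deriv g x = 0 :=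
    ⟨image_eq_zero_of_notMem_tsupport fun h => hx (hsupp h),
      image_eq_zero_of_notMem_tsupport fun h => hx (hsupp (tsupport_deriv_subset h))⟩
  obtain ⟨hg0, hg'0⟩ := hzero (x := 0) fun h => h.1.not_gt ha
  obtain ⟨hgb, hg'b⟩ := hzero (x := b + 1) fun h => by linarith [h.2]
  refine ⟨b + 1, _, fun x hx => ?_, hu.mul (hg.hasACDeriv.clm_comp Complex.ofRealCLM)
    (hg.deriv.hasACDeriv.clm_comp Complex.ofRealCLM), by linarith, ?_, ?_, ?_, ?_, ?_⟩
  · obtain ⟨hxa, hxb⟩ := hsupp (subset_tsupport g hx)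
    exact ⟨ha.trans_le hxa, hxb.trans (by linarith)⟩
  · have hg' := (hg.deriv.hasACDeriv.clm_comp Complex.ofRealCLM).continuousOn
    have hg'' := (hg.deriv.deriv.hasACDeriv.clm_comp Complex.ofRealCLM).continuousOn
    refine (((hu.memL2Loc_deriv hs).mul_continuousOn (hg'.const_smul (-2 : ℂ))).add
      (.of_continuousOn (hu.fst.continuousOn.mul hg'').neg)).congr (.of_forall fun x => ?_)
    simp only [Complex.ofRealCLM_apply, smul_eq_mul, Pi.zero_apply, Pi.smul_apply, Pi.neg_apply,
      Pi.mul_apply]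
    ring
  all_goals simp [hg0, hg'0, hgb, hg'b]

theorem IsQuasiSolution.integral_im_mul_norm_sq {s u w : ℝ → ℂ} {m : ℝ} (hs : MemL2Loc s)
    (hm : HasFormBound s m) (hu : IsQuasiSolution s 0 u w) {g : ℝ → ℝ} (hg : IsTestFunction g) :
    ∫ x, (2 * g x * deriv g x * ((s x).im * ‖u x‖ ^ 2) +
      g x ^ 2 * ((s x).im * (2 * ((s x * u x + w x) * conj (u x)).re))) = 0 := by
  obtain ⟨N, v, hsupp, hmin⟩ := hu.exists_isMinimalSolution_mul hs hg
  have h0 := hmin.integral_im_mul_eq_zero (hm _ _ _ _ hmin).1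
  rw [intervalIntegral.integral_eq_integral_of_support_subset fun x hx => hsupp fun hgx =>
    hx (by simp [hgx])] at h0
  rw [← h0]
  refine integral_congr_ae (.of_forall fun x => ?_)
  have hnorm : ‖u x‖ ^ 2 = (u x).re ^ 2 + (u x).im ^ 2 := by
    rw [Complex.sq_norm, Complex.normSq_apply]
    ring
  simp only [hnorm, map_mul, Complex.conj_ofReal, Complex.add_re, Complex.add_im, Complex.mul_re,
    Complex.mul_im, Complex.conj_re, Complex.conj_im, Complex.ofReal_re, Complex.ofReal_im]
  ring

theorem ae_eq_div_of_hasACDeriv_mul {κ p p' Q : ℝ → ℝ} (hp : HasACDeriv p p')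
    (hp0 : ∀ x, 0 ≤ x → p x ≠ 0) (hQ : HasACDeriv Q (fun x => κ x * p' x))
    (h : (fun x => κ x * p x) =ᵐ[halfLine] Q) : ∀ᵐ x ∂halfLine, κ x = Q 0 / p 0 := by
  have hdiv := hQ.mul (hp.inv hp0)
  have hpos : ∀ᵐ x ∂halfLine, 0 ≤ x := ae_restrict_mem measurableSet_Ici
  have hzero : ∀ᵐ x ∂halfLine, κ x * p' x * (p x)⁻¹ + Q x * -(p' x * (p x)⁻¹ ^ 2) = 0 := by
    filter_upwards [h, hpos] with x hx hx0
    have := hp0 x hx0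
    rw [← hx]
    field_simp
    ring
  filter_upwards [h, hpos] with x hx hx0
  rw [div_eq_mul_inv, ← hdiv.eq_of_ae_eq_zero hzero hx0, ← hx, mul_inv_cancel_right₀ (hp0 x hx0)]

theorem exists_ae_im_eq_of_hasFormBound {s : ℝ → ℂ} {m : ℝ} (hs : MemL2Loc s)
    (hm : HasFormBound s m) : ∃ c, ∀ᵐ x ∂halfLine, (s x).im = c := by
  have him : MemL2Loc fun x => (s x).im := fun b => (hs b).im
  obtain ⟨u₁, w₁, hu₁, h₁, h₁'⟩ := exists_isQuasiSolution_zero hs 1 0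
  obtain ⟨u₂, w₂, hu₂, h₂, h₂'⟩ := exists_isQuasiSolution_zero hs 0 1
  have hp := hu₁.hasACDeriv_norm_sq.add hu₂.hasACDeriv_norm_sq
  have hp0 (x : ℝ) (hx : 0 ≤ x) : ‖u₁ x‖ ^ 2 + ‖u₂ x‖ ^ 2 ≠ 0 := by
    intro h0
    have hw := (hu₁.wronskian hu₂).eq_of_ae_eq_zero (.of_forall fun x => by simp) hx
    obtain ⟨h1, h2⟩ := (add_eq_zero_iff_of_nonneg (by positivity) (by positivity)).1 h0
    rw [sq_eq_zero_iff, norm_eq_zero] at h1 h2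
    simp [h1, h2, h₁, h₁', h₂, h₂'] at hw
  have hp' {u w : ℝ → ℂ} (hu : IsQuasiSolution s 0 u w) {g : ℝ → ℝ} (hg : IsTestFunction g) :=
    hg.integrable_mul_deriv_add_sq_mul
      (him.mul_continuousOn hu.hasACDeriv_norm_sq.continuousOn).locallyIntegrableOn
      (him.locallyIntegrableOn_mul (hu.memL2Loc_deriv_norm_sq hs))
  obtain ⟨Q, hQ, hκ⟩ := exists_hasACDeriv_ae_eq_of_forall_mul_self
    (him.mul_continuousOn hp.continuousOn).locallyIntegrableOn (him.locallyIntegrableOn_mul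
      ((hu₁.memL2Loc_deriv_norm_sq hs).add (hu₂.memL2Loc_deriv_norm_sq hs))) fun g hg => by
    rw [← add_zero (0 : ℝ)]
    nth_rw 1 [← hu₁.integral_im_mul_norm_sq hs hm hg]
    rw [← hu₂.integral_im_mul_norm_sq hs hm hg, ← integral_add (hp' hu₁ hg) (hp' hu₂ hg)]
    refine integral_congr_ae (.of_forall fun x => ?_)
    ring
  exact ⟨_, ae_eq_div_of_hasACDeriv_mul hp hp0 hQ hκ⟩

end ImaginaryPart

section PhaseAmplitude

open scoped Real

theorem IsMinimalSolution.ofReal {σ v y z : ℝ → ℝ} {N : ℝ} (h : IsMinimalSolution σ N v y z) :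
    IsMinimalSolution (fun x => (σ x : ℂ)) N (fun x => (v x : ℂ)) (fun x => (y x : ℂ))
      (fun x => (z x : ℂ)) where
  toIsQuasiSolution := h.toIsQuasiSolution.ofReal
  nonneg := h.nonneg
  memL2Loc b := (h.memL2Loc b).ofReal
  init := by rw [h.init, Complex.ofReal_zero]
  quasi_init := by rw [h.quasi_init, Complex.ofReal_zero]
  final := by rw [h.final, Complex.ofReal_zero]
  quasi_final := by rw [h.quasi_final, Complex.ofReal_zero]

theorem HasFormBound.mul_integral_sq_le {σ v y z : ℝ → ℝ} {m N : ℝ}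
    (hm : HasFormBound (fun x => (σ x : ℂ)) m) (h : IsMinimalSolution σ N v y z) :
    m * ∫ x in (0 : ℝ)..N, y x ^ 2 ≤ ∫ x in (0 : ℝ)..N, y x * v x := by
  have hre := (hm _ _ _ _ h.ofReal).2
  simpa only [Complex.conj_ofReal, ← Complex.ofReal_mul, intervalIntegral.integral_ofReal,
    Complex.ofReal_re, Complex.norm_real, Real.norm_eq_abs, sq_abs] using hre

/-- Phase-amplitude variables for the equation `l(u) = 0` with a real antiderivative `σ`: the
solutions are the linear combinations of `ρ sin θ` and `ρ cos θ`. The amplitude `ρ`, whose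
quasi-derivative is `ω`, solves the Ermakov equation `l(ρ) = -ρ⁻³`. -/
structure IsPhaseAmplitude (σ ρ ω θ : ℝ → ℝ) : Prop where
  amplitude : IsQuasiSolution σ (fun x => -(ρ x)⁻¹ ^ 3) ρ ω
  phase : HasACDeriv θ (fun x => (ρ x)⁻¹ ^ 2)
  amplitude_pos : ∀ x, 0 ≤ x → 0 < ρ x
  phase_zero : θ 0 = 0

theorem IsQuasiSolution.sqrt_sq_add_sq {σ u₁ w₁ u₂ w₂ : ℝ → ℝ} (h₁ : IsQuasiSolution σ 0 u₁ w₁)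
    (h₂ : IsQuasiSolution σ 0 u₂ w₂) (hW : ∀ x, 0 ≤ x → u₁ x * w₂ x - w₁ x * u₂ x = 1)
    (hpos : ∀ x, 0 ≤ x → 0 < u₁ x ^ 2 + u₂ x ^ 2) :
    IsQuasiSolution σ (fun x => -(√(u₁ x ^ 2 + u₂ x ^ 2))⁻¹ ^ 3) (fun x => √(u₁ x ^ 2 + u₂ x ^ 2))
      (fun x => (u₁ x * w₁ x + u₂ x * w₂ x) * (√(u₁ x ^ 2 + u₂ x ^ 2))⁻¹) := by
  let ρ : ℝ → ℝ := fun x => √(u₁ x ^ 2 + u₂ x ^ 2)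
  change IsQuasiSolution σ (fun x => -(ρ x)⁻¹ ^ 3) ρ
    (fun x => (u₁ x * w₁ x + u₂ x * w₂ x) * (ρ x)⁻¹)
  have hρpos (x : ℝ) (hx : 0 ≤ x) : 0 < ρ x := Real.sqrt_pos.2 (hpos x hx)
  have hρsq (x : ℝ) (hx : 0 ≤ x) : ρ x ^ 2 = u₁ x ^ 2 + u₂ x ^ 2 := Real.sq_sqrt (hpos x hx).le
  have hsum := ((h₁.fst.mul h₁.fst).add (h₂.fst.mul h₂.fst)).congr
    (fun x _ => show _ = u₁ x ^ 2 + u₂ x ^ 2 by ring) .rfl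
  have hρ : HasACDeriv ρ (fun x => σ x * ρ x + (u₁ x * w₁ x + u₂ x * w₂ x) * (ρ x)⁻¹) := by
    refine (hsum.sqrt fun x hx => (hpos x hx).ne').congr_deriv ?_
    filter_upwards [ae_restrict_mem measurableSet_Ici] with x hx
    have := (hρpos x hx).ne'
    change _ * (ρ x)⁻¹ = _
    field_simp
    linear_combination -2 * σ x * hρsq x hx
  refine ⟨hρ, (((h₁.fst.mul h₁.snd).add (h₂.fst.mul h₂.snd)).mul
    (hρ.inv fun x hx => (hρpos x hx).ne')).congr_deriv ?_⟩
  filter_upwards [ae_restrict_mem measurableSet_Ici] with x hx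
  have := (hρpos x hx).ne'
  simp only [Pi.zero_apply]
  field_simp
  linear_combination (w₁ x ^ 2 + w₂ x ^ 2 + σ x ^ 2 * ρ x ^ 2) * hρsq x hx +
    (u₁ x * w₂ x - w₁ x * u₂ x + 1) * hW x hx

theorem exists_isPhaseAmplitude {σ : ℝ → ℝ} (hσ : MemL2Loc σ) :
    ∃ ρ ω θ, IsPhaseAmplitude σ ρ ω θ := by
  obtain ⟨u₁, w₁, hu₁, h₁, h₁'⟩ := exists_isQuasiSolution_zero hσ 1 0
  obtain ⟨u₂, w₂, hu₂, h₂, h₂'⟩ := exists_isQuasiSolution_zero hσ 0 1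
  have hW (x : ℝ) (hx : 0 ≤ x) : u₁ x * w₂ x - w₁ x * u₂ x = 1 := by
    rw [(hu₁.wronskian hu₂).eq_of_ae_eq_zero (.of_forall fun x => by simp) hx]
    simp [h₁, h₁', h₂, h₂']
  have hpos (x : ℝ) (hx : 0 ≤ x) : 0 < u₁ x ^ 2 + u₂ x ^ 2 := by
    by_contra! h0
    have h1 : u₁ x = 0 := by nlinarith [sq_nonneg (u₁ x), sq_nonneg (u₂ x)]
    have h2 : u₂ x = 0 := by nlinarith [sq_nonneg (u₁ x), sq_nonneg (u₂ x)]
    simpa [h1, h2] using hW x hx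
  have hρ := hu₁.sqrt_sq_add_sq hu₂ hW hpos
  have hρpos (x : ℝ) (hx : 0 ≤ x) := Real.sqrt_pos.2 (hpos x hx)
  have hcont : ContinuousOn (fun x => (√(u₁ x ^ 2 + u₂ x ^ 2))⁻¹ ^ 2) (Ici 0) :=
    (hρ.fst.continuousOn.inv₀ fun x hx => (hρpos x hx).ne').pow 2
  exact ⟨_, _, _, hρ, .primitive (hcont.locallyIntegrableOn measurableSet_Ici) 0, hρpos, by simp⟩

theorem integral_neg_mul_deriv_deriv_add_sq_eq {φ : ℝ → ℝ} (hφ : ContDiff ℝ 2 φ) {a b : ℝ}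
    (ha : φ a = 0) (hb : φ b = 0) :
    ∫ t in a..b, -(φ t * deriv (deriv φ) t + φ t ^ 2) =
      ∫ t in a..b, (deriv φ t ^ 2 - φ t ^ 2) := by
  have hφ' : ContDiff ℝ 1 (deriv φ) := (contDiff_succ_iff_deriv.1 hφ).2.2
  have hφc := hφ.continuous
  have hφc' := hφ'.continuous
  have hφc'' : Continuous (deriv (deriv φ)) := hφ'.continuous_deriv_one
  have hparts : ∫ t in a..b, φ t * deriv (deriv φ) t = -∫ t in a..b, deriv φ t * deriv φ t := by
    rw [intervalIntegral.integral_mul_deriv_eq_deriv_mul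
      (fun t _ => (hφ.differentiable two_ne_zero t).hasDerivAt)
      (fun t _ => (hφ'.differentiable one_ne_zero t).hasDerivAt)
      (hφc'.intervalIntegrable _ _) (hφc''.intervalIntegrable _ _), ha, hb]
    simp
  rw [intervalIntegral.integral_neg, intervalIntegral.integral_add, hparts,
    intervalIntegral.integral_sub]
  · simp only [sq]
    ring
  all_goals exact Continuous.intervalIntegrable (by fun_prop) _ _

-- `η ∘ φ` approximates `φ` and has zero derivative wherever `φ` vanishes, as required by the
-- boundary conditions of the minimal operator.
theorem exists_contDiff_sq_sub_mul_abs_le {ε : ℝ} (hε : 0 < ε) :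
    ∃ η : ℝ → ℝ, ContDiff ℝ 2 η ∧ η 0 = 0 ∧ deriv η 0 = 0 ∧ (∀ s, deriv η s ^ 2 ≤ 1) ∧
      ∀ s, s ^ 2 - ε * |s| ≤ η s ^ 2 := by
  let c := ε / π
  have hc : 0 < c := div_pos hε Real.pi_pos
  have hderiv : deriv (fun s => s - c * Real.arctan (s / c)) =
      fun s => 1 - (1 + (s / c) ^ 2)⁻¹ := by
    funext s
    refine (((hasDerivAt_id s).fun_sub
      (((hasDerivAt_id s).div_const c).arctan.const_mul c)).congr_deriv ?_).deriv
    simp only [_root_.id]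
    field_simp
  refine ⟨fun s => s - c * Real.arctan (s / c), ?_, by simp, by simp [hderiv], fun s => ?_,
    fun s => ?_⟩
  · exact contDiff_id.sub (contDiff_const.mul (Real.contDiff_arctan.comp (contDiff_id.div_const c)))
  · have hle : (1 + (s / c) ^ 2)⁻¹ ≤ 1 := inv_le_one_of_one_le₀ (by nlinarith [sq_nonneg (s / c)])
    have hpos : 0 < (1 + (s / c) ^ 2)⁻¹ := by positivity
    rw [hderiv]
    nlinarith
  · have harctan : |Real.arctan (s / c)| ≤ π / 2 :=
      abs_le.2 ⟨(Real.neg_pi_div_two_lt_arctan _).le, (Real.arctan_lt_pi_div_two _).le⟩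
    have hcross : s * Real.arctan (s / c) ≤ |s| * (π / 2) := by
      grw [le_abs_self (s * _), abs_mul, harctan]
    have hεc : ε = c * π := (div_mul_cancel₀ _ Real.pi_ne_zero).symm
    rw [hεc]
    nlinarith [sq_nonneg (c * Real.arctan (s / c))]

namespace IsPhaseAmplitude

variable {σ ρ ω θ : ℝ → ℝ}

theorem hasACDeriv_comp_phase (h : IsPhaseAmplitude σ ρ ω θ) {F : ℝ → ℝ}
    (hF : ContDiff ℝ 1 F) :
    HasACDeriv (fun x => F (θ x)) (fun x => deriv F (θ x) * (ρ x)⁻¹ ^ 2) :=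
  h.phase.comp F fun _ _ => hF.contDiffAt

theorem isQuasiSolution_comp (h : IsPhaseAmplitude σ ρ ω θ) {φ : ℝ → ℝ} (hφ : ContDiff ℝ 2 φ) :
    IsQuasiSolution σ (fun x => -(deriv (deriv φ) (θ x) + φ (θ x)) * (ρ x)⁻¹ ^ 3)
      (fun x => ρ x * φ (θ x)) (fun x => ω x * φ (θ x) + deriv φ (θ x) * (ρ x)⁻¹) := by
  have hinv := h.amplitude.fst.inv fun x hx => (h.amplitude_pos x hx).ne'
  have hφ' : ContDiff ℝ 1 (deriv φ) := (contDiff_succ_iff_deriv.1 hφ).2.2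
  have hmul := h.amplitude.mul (h.hasACDeriv_comp_phase (hφ.of_le one_le_two))
    ((h.hasACDeriv_comp_phase hφ').mul (hinv.mul hinv) |>.congr
      (g := fun x => deriv φ (θ x) * (ρ x)⁻¹ ^ 2) (fun x _ => by ring) .rfl)
  constructor
  · refine hmul.fst.congr_deriv ?_
    filter_upwards [ae_restrict_mem measurableSet_Ici] with x hx
    have := (h.amplitude_pos x hx).ne'
    field_simp
  · refine (hmul.snd.congr (fun x hx => ?_) ?_)
    · have := (h.amplitude_pos x hx).ne'
      field_simp
    filter_upwards [ae_restrict_mem measurableSet_Ici] with x hx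
    have := (h.amplitude_pos x hx).ne'
    field_simp
    ring

theorem intervalIntegrable_sq_mul_comp (h : IsPhaseAmplitude σ ρ ω θ) {F : ℝ → ℝ}
    (hF : Continuous F) {N : ℝ} (hN : 0 ≤ N) :
    IntervalIntegrable (fun x => ρ x ^ 2 * F (θ x)) volume 0 N :=
  (((h.amplitude.fst.continuousOn.pow 2).mul (hF.comp_continuousOn h.phase.continuousOn)).mono
    Icc_subset_Ici_self).intervalIntegrable_of_Icc hN

theorem integral_comp_mul (h : IsPhaseAmplitude σ ρ ω θ) {F : ℝ → ℝ} (hF : Continuous F)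
    {N : ℝ} (hN : 0 ≤ N) :
    ∫ x in (0 : ℝ)..N, F (θ x) * (ρ x)⁻¹ ^ 2 = ∫ t in (0 : ℝ)..θ N, F t := by
  have hderiv : deriv (fun x => ∫ t in (0 : ℝ)..x, F t) = F :=
    funext fun x => hF.deriv_integral _ _ x
  have hsmooth : ContDiff ℝ 1 fun x => ∫ t in (0 : ℝ)..x, F t := contDiff_one_iff_deriv.2
    ⟨fun x => (hF.integral_hasStrictDerivAt 0 x).hasDerivAt.differentiableAt, by rwa [hderiv]⟩
  have hcomp := h.hasACDeriv_comp_phase hsmooth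
  rw [hderiv] at hcomp
  simpa [h.phase_zero] using hcomp.integral_eq_sub le_rfl hN

theorem isMinimalSolution_comp (h : IsPhaseAmplitude σ ρ ω θ) {N : ℝ} (hN : 0 ≤ N) {φ : ℝ → ℝ}
    (hφ : ContDiff ℝ 2 φ) (h0 : φ 0 = 0) (h0' : deriv φ 0 = 0) (hT : φ (θ N) = 0)
    (hT' : deriv φ (θ N) = 0) :
    IsMinimalSolution σ N (fun x => -(deriv (deriv φ) (θ x) + φ (θ x)) * (ρ x)⁻¹ ^ 3)
      (fun x => ρ x * φ (θ x)) (fun x => ω x * φ (θ x) + deriv φ (θ x) * (ρ x)⁻¹) where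
  toIsQuasiSolution := h.isQuasiSolution_comp hφ
  nonneg := hN
  memL2Loc := by
    have hφ'' : Continuous (deriv (deriv φ)) :=
      (contDiff_succ_iff_deriv.1 hφ).2.2.continuous_deriv_one
    have hρ := h.amplitude.fst.continuousOn.inv₀ fun x hx => (h.amplitude_pos x hx).ne'
    exact .of_continuousOn
      (((hφ''.add hφ.continuous).neg.comp_continuousOn h.phase.continuousOn).mul (hρ.pow 3))
  init := by simp [h.phase_zero, h0]
  quasi_init := by simp [h.phase_zero, h0, h0']
  final := by simp [hT]
  quasi_final := by simp [hT, hT']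

theorem mul_integral_le_of_deriv_eq_zero (h : IsPhaseAmplitude σ ρ ω θ) {m N : ℝ}
    (hm : HasFormBound (fun x => (σ x : ℂ)) m) (hN : 0 ≤ N) {φ : ℝ → ℝ} (hφ : ContDiff ℝ 2 φ)
    (h0 : φ 0 = 0) (h0' : deriv φ 0 = 0) (hT : φ (θ N) = 0) (hT' : deriv φ (θ N) = 0) :
    m * ∫ x in (0 : ℝ)..N, ρ x ^ 2 * φ (θ x) ^ 2 ≤
      ∫ t in (0 : ℝ)..θ N, (deriv φ t ^ 2 - φ t ^ 2) := by
  have hφc := hφ.continuous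
  have : Continuous (deriv (deriv φ)) :=
    (contDiff_succ_iff_deriv.1 hφ).2.2.continuous_deriv_one
  have hform := hm.mul_integral_sq_le (h.isMinimalSolution_comp hN hφ h0 h0' hT hT')
  simp only [mul_pow] at hform
  calc m * ∫ x in (0 : ℝ)..N, ρ x ^ 2 * φ (θ x) ^ 2
    _ ≤ ∫ x in (0 : ℝ)..N, -(φ (θ x) * deriv (deriv φ) (θ x) + φ (θ x) ^ 2) * (ρ x)⁻¹ ^ 2 := by
      refine hform.trans_eq (intervalIntegral.integral_congr fun x hx => ?_)
      rw [uIcc_of_le hN] at hx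
      have := (h.amplitude_pos x hx.1).ne'
      field_simp
    _ = ∫ t in (0 : ℝ)..θ N, -(φ t * deriv (deriv φ) t + φ t ^ 2) :=
      h.integral_comp_mul (F := fun t => -(φ t * deriv (deriv φ) t + φ t ^ 2)) (by fun_prop) hN
    _ = ∫ t in (0 : ℝ)..θ N, (deriv φ t ^ 2 - φ t ^ 2) :=
      integral_neg_mul_deriv_deriv_add_sq_eq hφ h0 hT

theorem phase_mono (h : IsPhaseAmplitude σ ρ ω θ) : MonotoneOn θ (Ici 0) := fun a ha b hb hab => by
  rw [← sub_nonneg, ← h.phase.integral_eq_sub ha hb]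
  exact intervalIntegral.integral_nonneg hab fun x _ => sq_nonneg _

theorem phase_pos (h : IsPhaseAmplitude σ ρ ω θ) {x : ℝ} (hx : 0 < x) : 0 < θ x := by
  have heq := h.phase.integral_eq_sub le_rfl hx.le
  rw [h.phase_zero, sub_zero] at heq
  rw [← heq]
  exact intervalIntegral.intervalIntegral_pos_of_pos_on
    (h.phase.intervalIntegrable le_rfl hx.le)
    (fun t ht => pow_pos (inv_pos.2 (h.amplitude_pos t ht.1.le)) 2) hx

theorem phase_nonneg (h : IsPhaseAmplitude σ ρ ω θ) {x : ℝ} (hx : 0 ≤ x) : 0 ≤ θ x :=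
  h.phase_zero.symm.trans_le (h.phase_mono self_mem_Ici hx hx)

theorem mul_integral_le_add_mul (h : IsPhaseAmplitude σ ρ ω θ) {m N ε : ℝ} (hm0 : 0 ≤ m)
    (hm : HasFormBound (fun x => (σ x : ℂ)) m) (hN : 0 ≤ N) {φ : ℝ → ℝ} (hφ : ContDiff ℝ 2 φ)
    (h0 : φ 0 = 0) (hT : φ (θ N) = 0) (hε : 0 < ε) :
    m * ∫ x in (0 : ℝ)..N, ρ x ^ 2 * φ (θ x) ^ 2 ≤
      (∫ t in (0 : ℝ)..θ N, (deriv φ t ^ 2 - φ t ^ 2)) +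
        (m * (∫ x in (0 : ℝ)..N, ρ x ^ 2 * |φ (θ x)|) + ∫ t in (0 : ℝ)..θ N, |φ t|) * ε := by
  obtain ⟨η, hη, hη0, hη0', hη', hηsq⟩ := exists_contDiff_sq_sub_mul_abs_le hε
  have hφc := hφ.continuous
  have hφc' := hφ.continuous_deriv one_le_two
  have hηc := hη.continuous
  have hηc' := hη.continuous_deriv one_le_two
  have hderiv : deriv (η ∘ φ) = fun t => deriv η (φ t) * deriv φ t := funext fun t =>
    deriv_comp t (hη.differentiable two_ne_zero _) (hφ.differentiable two_ne_zero _)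
  have hlower : (∫ x in (0 : ℝ)..N, ρ x ^ 2 * φ (θ x) ^ 2) -
      (∫ x in (0 : ℝ)..N, ρ x ^ 2 * |φ (θ x)|) * ε ≤
      ∫ x in (0 : ℝ)..N, ρ x ^ 2 * η (φ (θ x)) ^ 2 := by
    have hint {F : ℝ → ℝ} (hF : Continuous F) := h.intervalIntegrable_sq_mul_comp hF hN
    have hsq := hint (F := fun t => φ t ^ 2) (by fun_prop)
    have habs := (hint hφc.abs).mul_const ε
    rw [← intervalIntegral.integral_mul_const, ← intervalIntegral.integral_sub hsq habs]
    refine intervalIntegral.integral_mono_on hN (hsq.sub habs) (hint ((hηc.comp hφc).pow 2))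
      fun x _ => ?_
    nlinarith [mul_le_mul_of_nonneg_left (hηsq (φ (θ x))) (sq_nonneg (ρ x))]
  have hupper : ∫ t in (0 : ℝ)..θ N, ((deriv η (φ t) * deriv φ t) ^ 2 - η (φ t) ^ 2) ≤
      (∫ t in (0 : ℝ)..θ N, (deriv φ t ^ 2 - φ t ^ 2)) + (∫ t in (0 : ℝ)..θ N, |φ t|) * ε := by
    rw [← intervalIntegral.integral_mul_const, ← intervalIntegral.integral_add
      (Continuous.intervalIntegrable (by fun_prop) _ _)
      (Continuous.intervalIntegrable (by fun_prop) _ _)]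
    refine intervalIntegral.integral_mono_on (h.phase_nonneg hN)
      (Continuous.intervalIntegrable (by fun_prop) _ _)
      (Continuous.intervalIntegrable (by fun_prop) _ _) fun t _ => ?_
    nlinarith [hηsq (φ t), mul_le_mul_of_nonneg_right (hη' (φ t)) (sq_nonneg (deriv φ t))]
  have hreg := h.mul_integral_le_of_deriv_eq_zero hm hN (hη.comp hφ) (by simp [h0, hη0])
    (by simp [hderiv, h0, hη0']) (by simp [hT, hη0]) (by simp [hderiv, hT, hη0'])
  simp only [Function.comp_apply, hderiv] at hreg
  linear_combination m * hlower + hreg + hupper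

theorem mul_integral_le (h : IsPhaseAmplitude σ ρ ω θ) {m N : ℝ} (hm0 : 0 ≤ m)
    (hm : HasFormBound (fun x => (σ x : ℂ)) m) (hN : 0 ≤ N) {φ : ℝ → ℝ} (hφ : ContDiff ℝ 2 φ)
    (h0 : φ 0 = 0) (hT : φ (θ N) = 0) :
    m * ∫ x in (0 : ℝ)..N, ρ x ^ 2 * φ (θ x) ^ 2 ≤
      ∫ t in (0 : ℝ)..θ N, (deriv φ t ^ 2 - φ t ^ 2) := by
  refine ge_of_tendsto (x := nhdsWithin (0 : ℝ) (Ioi 0)) (f := fun ε =>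
    (∫ t in (0 : ℝ)..θ N, (deriv φ t ^ 2 - φ t ^ 2)) +
      (m * (∫ x in (0 : ℝ)..N, ρ x ^ 2 * |φ (θ x)|) + ∫ t in (0 : ℝ)..θ N, |φ t|) * ε)
    (Filter.Tendsto.mono_left (Continuous.tendsto' (by fun_prop) 0 _ ?_) nhdsWithin_le_nhds) ?_
  · rw [mul_zero, add_zero]
  filter_upwards [self_mem_nhdsWithin] with ε hε
    using h.mul_integral_le_add_mul hm0 hm hN hφ h0 hT hε

theorem mul_integral_sin_sq_le (h : IsPhaseAmplitude σ ρ ω θ) {m N : ℝ} (hm0 : 0 ≤ m)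
    (hm : HasFormBound (fun x => (σ x : ℂ)) m) (hN : 0 < N) :
    m * ∫ x in (0 : ℝ)..N, ρ x ^ 2 * Real.sin (π / θ N * θ x) ^ 2 ≤
      ((π / θ N) ^ 2 - 1) * θ N / 2 := by
  have hθ := h.phase_pos hN
  have hk : π / θ N * θ N = π := div_mul_cancel₀ _ hθ.ne'
  have hk0 : π / θ N ≠ 0 := (div_pos Real.pi_pos hθ).ne'
  have hderiv : deriv (fun t => Real.sin (π / θ N * t)) =
      fun t => π / θ N * Real.cos (π / θ N * t) := funext fun t => by
    simp [mul_comm]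
  refine (h.mul_integral_le hm0 hm hN.le (φ := fun t => Real.sin (π / θ N * t)) (by fun_prop)
    (by simp) (by simp [hk])).trans_eq ?_
  simp only [hderiv, mul_pow]
  rw [intervalIntegral.integral_sub (Continuous.intervalIntegrable (by fun_prop) _ _)
    (Continuous.intervalIntegrable (by fun_prop) _ _), intervalIntegral.integral_const_mul,
    intervalIntegral.integral_comp_mul_left (fun t => Real.cos t ^ 2) hk0,
    intervalIntegral.integral_comp_mul_left (fun t => Real.sin t ^ 2) hk0, hk, integral_cos_sq,
    integral_sin_sq]
  simp only [mul_zero, Real.sin_zero, Real.sin_pi, zero_mul, smul_eq_mul]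
  field_simp
  ring

theorem eight_mul_integral_le (h : IsPhaseAmplitude σ ρ ω θ) {m a N : ℝ} (hm0 : 0 ≤ m)
    (hm : HasFormBound (fun x => (σ x : ℂ)) m) (ha : 0 < a) (haN : a ≤ N) (hθa : θ a ≤ θ N / 2) :
    8 * (m * ∫ x in (0 : ℝ)..a, ρ x ^ 2 * θ x ^ 2) ≤ (π ^ 2 - θ N ^ 2) * θ N := by
  have hN := ha.trans_le haN
  have hθ := h.phase_pos hN
  have hint {b : ℝ} := h.intervalIntegrable_sq_mul_comp (N := b)
    (F := fun t => Real.sin (π / θ N * t) ^ 2) (by fun_prop)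
  have hsin (x : ℝ) (hx : x ∈ Icc 0 a) :
      (2 / θ N) ^ 2 * (ρ x ^ 2 * θ x ^ 2) ≤ ρ x ^ 2 * Real.sin (π / θ N * θ x) ^ 2 := by
    have hθx := h.phase_nonneg hx.1
    have hle : π / θ N * θ x ≤ π / 2 := by
      have := (h.phase_mono hx.1 ha.le hx.2).trans hθa
      calc π / θ N * θ x ≤ π / θ N * (θ N / 2) := by gcongr
        _ = π / 2 := by field_simp
    have hlin : 2 / θ N * θ x ≤ Real.sin (π / θ N * θ x) :=
      (Real.mul_le_sin (by positivity) hle).trans_eq' (by field_simp)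
    calc (2 / θ N) ^ 2 * (ρ x ^ 2 * θ x ^ 2) = ρ x ^ 2 * (2 / θ N * θ x) ^ 2 := by ring
      _ ≤ ρ x ^ 2 * Real.sin (π / θ N * θ x) ^ 2 := by gcongr
  have hmain : m * ((2 / θ N) ^ 2 * ∫ x in (0 : ℝ)..a, ρ x ^ 2 * θ x ^ 2) ≤
      ((π / θ N) ^ 2 - 1) * θ N / 2 := by
    refine le_trans (mul_le_mul_of_nonneg_left ?_ hm0) (h.mul_integral_sin_sq_le hm0 hm hN)
    rw [← intervalIntegral.integral_const_mul]
    refine (intervalIntegral.integral_mono_on ha.le ((h.intervalIntegrable_sq_mul_comp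
      (F := fun t => t ^ 2) (by fun_prop) ha.le).const_mul _) (hint ha.le) hsin).trans ?_
    exact intervalIntegral.integral_mono_interval le_rfl ha.le haN
      (.of_forall fun x => mul_nonneg (sq_nonneg _) (sq_nonneg _)) (hint hN.le)
  have := mul_le_mul_of_nonneg_left hmain (show 0 ≤ 2 * θ N ^ 2 by positivity)
  field_simp at this ⊢
  linarith

theorem exists_phase_le (h : IsPhaseAmplitude σ ρ ω θ) {m : ℝ} (hm0 : 0 < m)
    (hm : HasFormBound (fun x => (σ x : ℂ)) m) : ∃ M < π, ∀ x, 0 ≤ x → θ x ≤ M := by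
  have h1pos := h.phase_pos one_pos
  obtain ⟨a, ha, hθa⟩ := intermediate_value_Icc zero_le_one
    (h.phase.continuousOn.mono Icc_subset_Ici_self)
    (show θ 1 / 2 ∈ Icc (θ 0) (θ 1) by rw [h.phase_zero]; constructor <;> linarith)
  have ha0 : 0 < a := ha.1.lt_of_ne fun h0 => by
    rw [← h0, h.phase_zero] at hθa
    linarith
  set ε := 8 * (m * ∫ x in (0 : ℝ)..a, ρ x ^ 2 * θ x ^ 2)
  have hε : 0 < ε := by
    have := intervalIntegral.intervalIntegral_pos_of_pos_on
      (h.intervalIntegrable_sq_mul_comp (F := fun t => t ^ 2) (by fun_prop) ha0.le)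
      (fun x hx => mul_pos (pow_pos (h.amplitude_pos x hx.1.le) 2)
        (pow_pos (h.phase_pos hx.1) 2)) ha0
    positivity
  have hbound (N : ℝ) (hN : 1 ≤ N) : θ N ^ 2 ≤ π ^ 2 - ε / π := by
    have hθN := h.phase_pos (one_pos.trans_le hN)
    have hmono := h.phase_mono (mem_Ici.2 zero_le_one) (mem_Ici.2 (zero_le_one.trans hN)) hN
    have hle := h.eight_mul_integral_le hm0.le hm ha0 (ha.2.trans hN) (by linarith)
    have hsq : 0 < π ^ 2 - θ N ^ 2 := pos_of_mul_pos_left (hε.trans_le hle) hθN.le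
    have hlt : θ N < π := lt_of_pow_lt_pow_left₀ 2 Real.pi_pos.le (by linarith)
    have : ε / π ≤ π ^ 2 - θ N ^ 2 := (div_le_iff₀ Real.pi_pos).2 (hle.trans (by gcongr))
    linarith
  refine ⟨√(π ^ 2 - ε / π), ?_, fun x hx => ?_⟩
  · rw [Real.sqrt_lt' Real.pi_pos]
    linarith [div_pos hε Real.pi_pos]
  · exact (h.phase_mono hx (hx.trans (le_max_left _ _)) (le_max_left x 1)).trans
      (Real.le_sqrt_of_sq_le (hbound _ (le_max_right _ _)))

end IsPhaseAmplitude

end PhaseAmplitude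

section Riccati

theorem exists_isQuasiSolution_zero_pos {σ : ℝ → ℝ} (hσ : MemL2Loc σ) {m : ℝ} (hm0 : 0 < m)
    (hm : HasFormBound (fun x => (σ x : ℂ)) m) :
    ∃ u w, IsQuasiSolution σ 0 u w ∧ ∀ x, 0 ≤ x → 0 < u x := by
  obtain ⟨ρ, ω, θ, h⟩ := exists_isPhaseAmplitude hσ
  obtain ⟨M, hM, hθ⟩ := h.exists_phase_le hm0 hm
  have hcos : deriv (fun t => Real.sin (t + (Real.pi - M) / 2)) =
      fun t => Real.cos (t + (Real.pi - M) / 2) := funext fun t => by simp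
  refine ⟨_, _, (h.isQuasiSolution_comp (φ := fun t => Real.sin (t + (Real.pi - M) / 2))
    (by fun_prop)).congr .rfl (.of_forall fun x => by simp [hcos]), fun x hx =>
    mul_pos (h.amplitude_pos x hx) (Real.sin_pos_of_pos_of_lt_pi ?_ ?_)⟩
  · linarith [h.phase_nonneg hx]
  · linarith [hθ x hx]

theorem IsQuasiSolution.exists_ae_eq_add_integral_sq {σ u w : ℝ → ℝ} (hσ : MemL2Loc σ)
    (h : IsQuasiSolution σ 0 u w) (hu : ∀ x, 0 ≤ x → u x ≠ 0) :
    ∃ (γ : ℝ → ℝ) (C : ℝ), MemL2Loc γ ∧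
      ∀ᵐ x ∂halfLine, σ x = γ x + (∫ t in (0 : ℝ)..x, γ t ^ 2) + C := by
  have hinv := h.fst.inv hu
  have hτ : HasACDeriv (fun x => w x * (u x)⁻¹) (fun x => -(σ x + w x * (u x)⁻¹) ^ 2) := by
    refine (h.snd.mul hinv).congr_deriv ?_
    filter_upwards [ae_restrict_mem measurableSet_Ici] with x hx
    have := hu x hx
    simp only [Pi.zero_apply]
    field_simp
    ring
  refine ⟨fun x => σ x + w x * (u x)⁻¹, -(w 0 * (u 0)⁻¹), hσ.add (.of_continuousOn hτ.continuousOn),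
    ?_⟩
  filter_upwards [ae_restrict_mem measurableSet_Ici] with x hx
  have := hτ.eq_add_integral x hx
  rw [intervalIntegral.integral_neg] at this
  linarith

end Riccati

section Shift

open scoped ComplexConjugate

theorem HasFormBound.of_ae_eq_add_affine {s s₀ : ℝ → ℂ} {m a : ℝ} {c : ℂ} (hm : HasFormBound s m)
    (hs : ∀ᵐ x ∂halfLine, s x = s₀ x + (a * x + c)) : HasFormBound s₀ (m - a) := by
  intro N v y z h
  have hr : HasACDeriv (fun x : ℝ => (a : ℂ) * x + c) (fun _ => (a : ℂ)) := by
    simpa using (HasACDeriv.id.clm_comp (a • Complex.ofRealCLM)).add (.const c)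
  have hsol : IsMinimalSolution s N (fun x => v x + a * y x) y
      (fun x => z x - (a * x + c) * y x) :=
    { toIsQuasiSolution :=
        (h.add_antideriv hr).congr (by filter_upwards [hs] with x hx using hx.symm) .rfl
      nonneg := h.nonneg
      memL2Loc := h.memL2Loc.add (.of_continuousOn (h.fst.continuousOn.const_smul (a : ℂ)))
      init := h.init
      quasi_init := by simp [h.init, h.quasi_init]
      final := h.final
      quasi_final := by simp [h.final, h.quasi_final] }
  have hvy := intervalIntegrable_of_locallyIntegrableOn_Ici h.locallyIntegrableOn_conj_mul le_rfl
    h.nonneg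
  have hyy : IntervalIntegrable (fun x => ((a * ‖y x‖ ^ 2 : ℝ) : ℂ)) volume 0 N :=
    ((Complex.continuous_ofReal.comp_continuousOn
      ((h.fst.continuousOn.norm.pow 2).const_smul a)).mono
      Icc_subset_Ici_self).intervalIntegrable_of_Icc h.nonneg
  have hform : ∫ x in (0 : ℝ)..N, conj (y x) * (v x + a * y x) =
      (∫ x in (0 : ℝ)..N, conj (y x) * v x) + ((a * ∫ x in (0 : ℝ)..N, ‖y x‖ ^ 2 : ℝ) : ℂ) := by
    rw [← intervalIntegral.integral_const_mul, ← intervalIntegral.integral_ofReal,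
      ← intervalIntegral.integral_add hvy hyy]
    congr with x
    push_cast
    linear_combination (a : ℂ) * Complex.conj_mul' (y x)
  obtain ⟨him, hre⟩ := hm _ _ _ _ hsol
  rw [hform] at him hre
  simp only [Complex.add_im, Complex.add_re, Complex.ofReal_im, Complex.ofReal_re, add_zero]
    at him hre
  exact ⟨him, by linarith⟩

end Shift

theorem mainTheorem8 (s : ℝ → ℂ) (hs : MemL2Loc s) :
    IsSemibounded (minimalOperator s) ↔
      ∃ (γ : ℝ → ℝ) (b : ℝ) (C : ℂ), MemL2Loc γ ∧
        ∀ᵐ x ∂halfLine,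
          s x = (b : ℂ) * x + γ x + ((∫ t in (0 : ℝ)..x, γ t ^ 2 : ℝ) : ℂ) + C := by
  rw [isSemibounded_minimalOperator_iff hs]
  constructor
  · rintro ⟨m, hm⟩
    obtain ⟨c, hc⟩ := exists_ae_im_eq_of_hasFormBound hs hm
    let σ : ℝ → ℝ := fun x => (s x).re - (m - 1) * x
    have hσ : MemL2Loc σ := fun b => (hs b).re.sub (MemL2Loc.of_continuousOn (by fun_prop) b)
    have hsσ : ∀ᵐ x ∂halfLine, s x = σ x + (((m - 1 : ℝ) : ℂ) * x + c * Complex.I) := by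
      filter_upwards [hc] with x hx
      rw [← Complex.re_add_im (s x), hx]
      push_cast [σ]
      ring
    obtain ⟨u, w, hu, hpos⟩ := exists_isQuasiSolution_zero_pos hσ (by norm_num)
      (hm.of_ae_eq_add_affine hsσ)
    obtain ⟨γ, C, hγ, hσγ⟩ := hu.exists_ae_eq_add_integral_sq hσ fun x hx => (hpos x hx).ne'
    refine ⟨γ, m - 1, C + c * Complex.I, hγ, ?_⟩
    filter_upwards [hsσ, hσγ] with x hx hx'
    rw [hx, hx']
    push_cast
    ring
  · rintro ⟨γ, b, C, hγ, h⟩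
    exact ⟨b, hasFormBound_of_ae_eq_add_integral_sq hγ h⟩
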